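/- Let $\Gamma=\mathrm{PSL}_2(\mathbb Z)$ act on the hyperbolic plane $\mathbb H$, let $G_0,G_1\subset\Gamma$ be the subgroups (of orders 2 and 3) generated by the classes of $\left(\begin{smallmatrix}0&-1\\1&0\end{smallmatrix}\right)$ and $\left(\begin{smallmatrix}0&1\\-1&1\end{smallmatrix}\right)$, and let $G\subset\Gamma$ be an arbitrary subgroup. Let $X_{\mathrm{comb}}(G)$ be the (multi)graph whose edges are the right cosets $Gg$, $g\in\Gamma$, whose vertices are the double cosets $GgG_0$ (type 0) and $GgG_1$ (type 1), i.e. the $G_0$- and $G_1$-orbits on $G\backslash\Gamma$, and in which the edge $Gg$ joins $GgG_0$ and $GgG_1$. Let $\mathbf T=X_{\mathrm{comb}}(\{1\})$, with edge set $\Gamma$ and vertex set $\Gamma/G_0\sqcup\Gamma/G_1$, so that $X_{\mathrm{comb}}(G)=G\backslash\mathbf T$. Let $\mathbf r$ be the geodesic segment from $\mathrm i$ to $\mathrm e^{\pi\mathrm i/3}$, let $\mathcal T=\bigcup_{g\in\Gamma}g\mathbf r$, and let $f:\mathbf T\to\mathcal T$ be the $\Gamma$-equivariant map that takes the vertices $G_0$,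 $G_1$ to $\mathrm i$, $\mathrm e^{\pi\mathrm i/3}$ and the edge $g$ to $g\mathbf r$. Let $\triangle$ be the hyperbolic triangle with vertices $0$, $\mathrm e^{\pi\mathrm i/3}$, $\infty$, without the vertices $0$ and $\infty$, and let $p:\mathbb H\to\mathcal T$ be a continuous $\Gamma$-equivariant retraction with $p(\triangle)=\mathbf r$ such that the points of $\triangle$ which $p$ takes to $\mathrm i$ are exactly those of the imaginary half-axis, and the points of $\triangle$ which $p$ takes to $\mathrm e^{\pi\mathrm i/3}$ are exactly those of the two other sides. (Such a $p$ exists.) 1. The (geometric realisation of the) graph $X_{\mathrm{comb}}(G)$ is homotopy equivalent to $G\backslash\mathbb H$. 2. It is possible to cut $X_{\mathrm{comb}}(G)$ at some of its vertices of valency 2 so as to obtain a tree (each of these vertices being replaced by two univalent ones). Whenever a tree $X'$ is obtained in this way, there is a lift $\jmath:X'\to\mathbf T$, i.e. a morphism of graphs whose composition with $\mathbf T\to G\backslash\mathbf T=X_{\mathrm{comb}}(G)$ is the natural map $X'\to X_{\mathrm{comb}}(G)$. For every such lift $\jmath$ put $P_0=p^{-1}(f(\jmath(X')))$ and let $P$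 be the closure of the interior of $P_0$. Then $P\subset P_0$, and every point of $P_0\setminus P$ is taken by $p$ to $f(\jmath(v))$ for some univalent vertex $v$ of type 1 of $X'$; in particular, $P=P_0$ if $G$ has no elements of order 3. The set $P$ is the union of the triangles $g\triangle$ over all edges $g\in\Gamma$ of $\jmath(X')$; it is a convex hyperbolic polygon (a geodesically convex set with non-empty interior which is the intersection of closed half-planes whose boundary geodesics form a locally finite family), which has finitely many sides if $G$ has finite index in $\Gamma$; and it is a fundamental domain for the action of $G$ on $\mathbb H$: it is the closure of its interior, its $G$-translates cover $\mathbb H$, and $P$ and $gP$ have disjoint interiors for every $1\neq g\in G$. -/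

import Mathlib

open scoped MatrixGroups UpperHalfPlane Pointwise ContinuousMap

noncomputable section

namespace ModularPolygon

/-! ### Multigraphs and their geometric realisations -/

/-- A multigraph (loops and parallel edges are allowed). Every edge `e` has two ends, labelled
`false` and `true`. -/
structure Multigraph where
  Vert : Type
  Edge : Type
  ends : Edge → Bool → Vert

namespace Multigraph

/-- Morphisms of multigraphs, preserving the labels of the ends of the edges. -/
@[ext]
structure Hom (X Y : Multigraph) where
  vert : X.Vert → Y.Vert
  edge : X.Edge → Y.Edge
  comm : ∀ e b, vert (X.ends e b) = Y.ends (edge e) b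

/-- Composition of morphisms. -/
def Hom.comp {X Y Z : Multigraph} (φ : Hom Y Z) (ψ : Hom X Y) : Hom X Z where
  vert := φ.vert ∘ ψ.vert
  edge := φ.edge ∘ ψ.edge
  comm e b := by simp only [Function.comp_apply, ψ.comm, φ.comm]

/-- The valency of a vertex: the number of half-edges that end there. -/
def valency (X : Multigraph) (v : X.Vert) : ℕ :=
  Nat.card {h : X.Edge × Bool // X.ends h.1 h.2 = v}

/-- The simple graph on the same vertices, two distinct vertices being adjacent iff some edge
joins them. -/
def toSimpleGraph (X : Multigraph) : SimpleGraph X.Vert :=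
  SimpleGraph.fromRel fun u v => ∃ e, X.ends e false = u ∧ X.ends e true = v

/-- A multigraph is a tree iff it has neither loops nor parallel edges and is a tree as a simple
graph (connected, non-empty and without cycles). -/
structure IsTree (X : Multigraph) : Prop where
  no_loops : ∀ e, X.ends e false ≠ X.ends e true
  no_parallel : Function.Injective fun e => s(X.ends e false, X.ends e true)
  simple_isTree : X.toSimpleGraph.IsTree

open Classical in
/-- Cutting `X` at the vertices of `C`: every `v ∈ C` is replaced by as many univalent vertices as
there are half-edges ending at `v`. -/
def cut (X : Multigraph) (C : Set X.Vert) : Multigraph where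
  Vert := {v : X.Vert // v ∉ C} ⊕ {h : X.Edge × Bool // X.ends h.1 h.2 ∈ C}
  Edge := X.Edge
  ends e b := if h : X.ends e b ∈ C then Sum.inr ⟨(e, b), h⟩ else Sum.inl ⟨X.ends e b, h⟩

/-- The obvious map that glues the cut graph together again. -/
def cutProj (X : Multigraph) (C : Set X.Vert) : Hom (X.cut C) X where
  vert := Sum.elim (fun v => v.1) (fun h => X.ends h.1.1 h.1.2)
  edge := fun e => e
  comm e b := by
    by_cases h : X.ends e b ∈ C <;> simp [cut, h]

instance (X : Multigraph) : TopologicalSpace X.Vert := ⊥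

instance (X : Multigraph) : TopologicalSpace X.Edge := ⊥

/-- The end `false` (resp. `true`) of an edge `e` is the point `0` (resp. `1`) of `{e} × [0, 1]`. -/
inductive Glue (X : Multigraph) :
    X.Vert ⊕ X.Edge × unitInterval → X.Vert ⊕ X.Edge × unitInterval → Prop
  | zero (e : X.Edge) : Glue X (Sum.inr (e, 0)) (Sum.inl (X.ends e false))
  | one (e : X.Edge) : Glue X (Sum.inr (e, 1)) (Sum.inl (X.ends e true))

/-- The geometric realisation of `X` as a one-dimensional CW complex: the quotient of the disjoint
union of the discrete set of vertices and one copy of `[0, 1]` for each edge. -/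
def Realization (X : Multigraph) : Type :=
  Quot X.Glue

instance (X : Multigraph) : TopologicalSpace X.Realization :=
  inferInstanceAs (TopologicalSpace (Quot X.Glue))

/-- The map between geometric realisations induced by a morphism. -/
def Hom.realize {X Y : Multigraph} (φ : Hom X Y) : X.Realization → Y.Realization :=
  Quot.map (Sum.map φ.vert (Prod.map φ.edge id)) (by
    rintro _ _ (e | e)
    · simpa [φ.comm] using Glue.zero (X := Y) (φ.edge e)
    · simpa [φ.comm] using Glue.one (X := Y) (φ.edge e))

end Multigraph

/-! ### The modular group, its action on the upper half-plane -/

lemma center_smul {g : SL(2, ℤ)} (hg : g ∈ Subgroup.center SL(2, ℤ)) (z : ℍ) : g • z = z := by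
  obtain ⟨r, hr, h⟩ := Matrix.SpecialLinearGroup.mem_center_iff.1 hg
  simp only [Fintype.card_fin, sq_eq_one_iff] at hr
  rcases hr with rfl | rfl
  · have : g = 1 := by ext i j; simp [← h, Matrix.one_apply]
    simp [this]
  · have : g = -1 := by ext i j; simp [← h]
    rw [this, ModularGroup.SL_neg_smul, one_smul]

/-- The action of `PSL(2, ℤ)` on the upper half-plane by Möbius transformations. -/
instance pslAction : MulAction PSL(2, ℤ) ℍ :=
  MulAction.compHom ℍ
    (QuotientGroup.lift (Subgroup.center SL(2, ℤ)) (MulAction.toPermHom SL(2, ℤ) ℍ)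
      (fun _ hg => Equiv.ext (center_smul hg)))

lemma mk_smul (g : SL(2, ℤ)) (z : ℍ) : (QuotientGroup.mk g : PSL(2, ℤ)) • z = g • z := rfl

/-- The matrix `(0, -1; 1, 0)`. -/
def matS : SL(2, ℤ) := ⟨!![0, -1; 1, 0], by simp⟩

/-- The matrix `(0, 1; -1, 1)`. -/
def matU : SL(2, ℤ) := ⟨!![0, 1; -1, 1], by simp⟩

/-- The subgroup `G₀` of order 2. -/
def G₀ : Subgroup PSL(2, ℤ) := Subgroup.zpowers (QuotientGroup.mk matS)

/-- The subgroup `G₁` of order 3. -/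
def G₁ : Subgroup PSL(2, ℤ) := Subgroup.zpowers (QuotientGroup.mk matU)

/-! ### The graphs -/

/-- The graph `X_comb(G)`: the edges are the right cosets `G g`, the vertices are the orbits of
`G₀` and `G₁` acting on the right on `G \ Γ`, i.e. the double cosets `G g G₀` (type 0) and `G g G₁`
(type 1), and the edge `G g` joins `G g G₀` and `G g G₁`. -/
def XComb (G : Subgroup PSL(2, ℤ)) : Multigraph where
  Vert := DoubleCoset.Quotient (G : Set PSL(2, ℤ)) (G₀ : Set PSL(2, ℤ)) ⊕
    DoubleCoset.Quotient (G : Set PSL(2, ℤ)) (G₁ : Set PSL(2, ℤ))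
  Edge := Quotient (QuotientGroup.rightRel G)
  ends x b := Quotient.liftOn' x
    (fun g => if b then Sum.inr (DoubleCoset.mk G G₁ g) else Sum.inl (DoubleCoset.mk G G₀ g))
    (by
      intro g g' h
      have h' : g' * g⁻¹ ∈ G := QuotientGroup.rightRel_apply.1 h
      have key : ∀ K : Subgroup PSL(2, ℤ), DoubleCoset.mk G K g = DoubleCoset.mk G K g' :=
        fun K => (DoubleCoset.eq G K g g').2 ⟨g' * g⁻¹, h', 1, K.one_mem, by simp⟩
      cases b <;> simp [key])

/-- The tree `𝐓`: the edges are the elements `g` of `Γ`, the vertices are the left cosets `g G₀`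
(type 0) and `g G₁` (type 1), and `g` joins `g G₀` and `g G₁`. -/
def treeT : Multigraph where
  Vert := (PSL(2, ℤ) ⧸ G₀) ⊕ (PSL(2, ℤ) ⧸ G₁)
  Edge := PSL(2, ℤ)
  ends g b := if b then Sum.inr (QuotientGroup.mk g) else Sum.inl (QuotientGroup.mk g)

/-- The map from left cosets of `K` to double cosets. -/
def toDoubleCoset (G K : Subgroup PSL(2, ℤ)) :
    PSL(2, ℤ) ⧸ K → DoubleCoset.Quotient (G : Set PSL(2, ℤ)) (K : Set PSL(2, ℤ)) := fun x =>
  Quotient.liftOn' x (fun g => DoubleCoset.mk G K g) (by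
    intro g g' h
    have h' : g⁻¹ * g' ∈ K := QuotientGroup.leftRel_apply.1 h
    exact (DoubleCoset.eq G K g g').2 ⟨1, G.one_mem, g⁻¹ * g', h', by simp⟩)

/-- The quotient map `𝐓 → G \ 𝐓 = X_comb(G)`. -/
def treeProj (G : Subgroup PSL(2, ℤ)) : Multigraph.Hom treeT (XComb G) where
  vert := Sum.map (toDoubleCoset G G₀) (toDoubleCoset G G₁)
  edge := fun g => Quotient.mk'' g
  comm e b := by cases b <;> rfl

/-! ### The tree in the upper half-plane -/

/-- The point `e^{πi/3}`. -/
def corner : ℍ := ⟨⟨1 / 2, √3 / 2⟩, by positivity⟩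

/-- A parametrisation of the geodesic segment `𝐫` from `i` to `e^{πi/3}`, an arc of the unit
circle. -/
def arc (t : unitInterval) : ℍ :=
  ⟨⟨(t : ℝ) / 2, √(1 - ((t : ℝ) / 2) ^ 2)⟩, by
    have h0 := t.2.1
    have h1 := t.2.2
    refine Real.sqrt_pos.2 ?_
    nlinarith⟩

/-- The segment `𝐫`. -/
def segR : Set ℍ := Set.range arc

lemma arc_zero : arc 0 = UpperHalfPlane.I := by
  apply UpperHalfPlane.ext
  apply Complex.ext <;> simp [arc]

lemma arc_one : arc 1 = corner := by
  have h : √(1 - ((1 : ℝ) / 2) ^ 2) = √3 / 2 := by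
    rw [show (1 : ℝ) - (1 / 2) ^ 2 = 3 / 2 ^ 2 by norm_num, Real.sqrt_div' _ (by positivity),
      Real.sqrt_sq (by positivity)]
  apply UpperHalfPlane.ext
  apply Complex.ext
  · simp [arc, corner]
  · simpa [arc, corner] using h

lemma matS_smul : matS • UpperHalfPlane.I = UpperHalfPlane.I := by
  apply UpperHalfPlane.ext
  rw [UpperHalfPlane.coe_specialLinearGroup_apply]
  simp [matS, UpperHalfPlane.I]

lemma matU_smul : matU • corner = corner := by
  apply UpperHalfPlane.ext
  rw [UpperHalfPlane.coe_specialLinearGroup_apply]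
  have h : (-(corner : ℂ) + 1) ≠ 0 := by
    intro h
    have := congrArg Complex.im h
    simp [corner] at this
  have h2 : √3 * √3 = (3 : ℝ) := Real.mul_self_sqrt (by norm_num)
  simp only [matU, Matrix.SpecialLinearGroup.coe_mk, Matrix.of_apply, Matrix.cons_val',
    Matrix.cons_val_zero, Matrix.cons_val_one, Matrix.cons_val_fin_one, algebraMap_int_eq, eq_intCast, Int.cast_zero, Int.cast_one,
    Int.cast_neg, Complex.ofReal_zero, Complex.ofReal_one, Complex.ofReal_neg, zero_mul, zero_add,
    neg_mul, one_mul]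
  rw [div_eq_iff h]
  apply Complex.ext
  · simp [corner]; nlinarith
  · simp [corner]; ring

/-- The orbit map of a point that is fixed by `γ`, on left cosets of the subgroup generated
by `γ`. -/
def cosetPoint (γ : PSL(2, ℤ)) (z : ℍ) (h : γ • z = z) : PSL(2, ℤ) ⧸ Subgroup.zpowers γ → ℍ :=
  fun x => Quotient.liftOn' x (fun g => g • z) (by
    intro g g' hg
    have h' : g⁻¹ * g' ∈ Subgroup.zpowers γ := QuotientGroup.leftRel_apply.1 hg
    have hle : Subgroup.zpowers γ ≤ MulAction.stabilizer PSL(2, ℤ) z :=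
      Subgroup.zpowers_le.2 h
    have h2 : (g⁻¹ * g') • z = z := hle h'
    change g • z = g' • z
    rw [mul_smul, inv_smul_eq_iff] at h2
    exact h2.symm)

/-- The point of `ℍ` that corresponds to a vertex of `𝐓`: `g G₀ ↦ g i`, `g G₁ ↦ g e^{πi/3}`. -/
def vertexPoint : treeT.Vert → ℍ :=
  Sum.elim (cosetPoint (QuotientGroup.mk matS) UpperHalfPlane.I matS_smul)
    (cosetPoint (QuotientGroup.mk matU) corner matU_smul)

/-- The `Γ`-equivariant map `f` from (the realisation of) `𝐓` to `ℍ` that takes `G₀` to `i`, `G₁` to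
`e^{πi/3}` and the edge `g` to the segment `g • 𝐫`. -/
def treeMap : treeT.Realization → ℍ :=
  Quot.lift (Sum.elim vertexPoint (fun x : PSL(2, ℤ) × unitInterval => x.1 • arc x.2)) (by
    rintro _ _ (e | e)
    · exact congrArg (fun z : ℍ => @HSMul.hSMul PSL(2, ℤ) ℍ ℍ _ e z) arc_zero
    · exact congrArg (fun z : ℍ => @HSMul.hSMul PSL(2, ℤ) ℍ ℍ _ e z) arc_one)

/-- The tree `𝓣` in the upper half-plane: the union of all `Γ`-copies of `𝐫`. -/
def hTree : Set ℍ := ⋃ g : PSL(2, ℤ), g • segR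

/-- The hyperbolic triangle with vertices `0`, `e^{πi/3}`, `∞`, without the vertices `0`, `∞`. -/
def triangle : Set ℍ := {z | 0 ≤ z.re ∧ z.re ≤ 1 / 2 ∧ 1 ≤ ‖(z : ℂ) - 1‖}

/-- The sides of the triangle other than the imaginary half-axis: the geodesic half-intervals that
join `e^{πi/3}` with `∞` and with `0`. -/
def cornerSides : Set ℍ := {z | z ∈ triangle ∧ (z.re = 1 / 2 ∨ ‖(z : ℂ) - 1‖ = 1)}

/-- `p` is a `Γ`-equivariant retraction of `ℍ` onto `𝓣` that restricts to a retraction of the triangle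
onto `𝐫`; the points of the triangle that it takes to `i` are those of the imaginary half-axis, the
points of the triangle that it takes to `e^{πi/3}` are those of the two other sides. -/
structure IsTreeRetraction (p : ℍ → ℍ) : Prop where
  continuous : Continuous p
  equivariant : ∀ (g : PSL(2, ℤ)) (z : ℍ), p (g • z) = g • p z
  mem_hTree : ∀ z, p z ∈ hTree
  fix_hTree : ∀ z ∈ hTree, p z = z
  mapsTo : Set.MapsTo p triangle segR
  eq_I_iff : ∀ z ∈ triangle, p z = UpperHalfPlane.I ↔ z.re = 0
  eq_corner_iff : ∀ z ∈ triangle, p z = corner ↔ z ∈ cornerSides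

/-! ### Hyperbolic geometry -/

/-- The geodesic segment between two points of the hyperbolic plane. -/
def geodesicSegment (z w : ℍ) : Set ℍ := {x | dist z x + dist x w = dist z w}

/-- Hyperbolic convexity. -/
def IsGeodesicallyConvex (P : Set ℍ) : Prop :=
  ∀ z ∈ P, ∀ w ∈ P, geodesicSegment z w ⊆ P

/-- A closed half-plane of the hyperbolic plane. The complete geodesics are the curves
`a |z|² + b Re z + c = 0` with `b² - 4 a c > 0` (half-circles centred on the real line and vertical
half-lines). -/
def IsClosedHalfPlane (H : Set ℍ) : Prop :=
  ∃ a b c : ℝ, 0 < b ^ 2 - 4 * a * c ∧ H = {z : ℍ | 0 ≤ a * ‖(z : ℂ)‖ ^ 2 + b * z.re + c}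

/-- A convex hyperbolic polygon, possibly with infinitely many sides and with vertices at infinity:
a convex set with non-empty interior that is the intersection of a family of closed half-planes
whose boundary geodesics form a locally finite family. -/
def IsConvexPolygon (P : Set ℍ) : Prop :=
  IsGeodesicallyConvex P ∧ (interior P).Nonempty ∧
    ∃ 𝓗 : Set (Set ℍ), (∀ H ∈ 𝓗, IsClosedHalfPlane H) ∧
      LocallyFinite (fun H : 𝓗 => frontier (H : Set ℍ)) ∧ P = ⋂₀ 𝓗

/-- The polygon `P` has finitely many sides. -/
def HasFinitelyManySides (P : Set ℍ) : Prop :=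
  ∃ 𝓗 : Set (Set ℍ), 𝓗.Finite ∧ (∀ H ∈ 𝓗, IsClosedHalfPlane H) ∧ P = ⋂₀ 𝓗

/-- `F` is a (closed) fundamental domain for the action of `G` on `ℍ`: it is the closure of its
interior, its `G`-translates cover `ℍ`, and different translates have disjoint interiors. -/
structure IsFundDomain (G : Subgroup PSL(2, ℤ)) (F : Set ℍ) : Prop where
  closure_interior : closure (interior F) = F
  cover : ⋃ g : G, g • F = Set.univ
  disjoint : ∀ g : G, g ≠ 1 → Disjoint (interior F) (interior (g • F))

end ModularPolygon

end

open ModularPolygon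

noncomputable section

namespace ModularPolygon


/-! ### Generators of the modular group -/

/-! Everything rests on ping-pong for the generators S = `gS` and U = `gU`. The element S exchanges
the two sides of the imaginary axis, and the nontrivial powers of U move the wedge at `corner`
containing the triangle △ off its interior. Hence a nonempty reduced word moves △ into a region
determined by its first syllable alone (`Reduced.smul_mem_side`). So the translates of △ tessellate
ℍ in the pattern of the tree 𝐓: two of them meet only along a common side, and then the edges share
a vertex (`triangle_inter`, `locallyFinite_triangle`).

Homotopy equivalence: a function on △ that is 0 on the imaginary side and 1 on the other two glues
to an equivariant map `toTree`. Followed by `treeMap` it is the required retraction. Points of ℍ are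
positive definite binary quadratic forms of determinant 1, and normalised convex combinations of
forms (`mix`) give a Γ-equivariant homotopy from the retraction to the identity, which descends to
G\ℍ.

Cuts: vertices of type 1 have valency 1 or 3, so only vertices of type 0 can be cut. A breadth-first
spanning tree shows where (`exists_cut_isTree`). Lifts exist because edges lift along 𝐓 → G\𝐓 and
paths in a tree are unique (`exists_section`).

Polygon: let E be the set of edges of a lift. It is a transversal of G\Γ, connected in 𝐓, and
contains both or neither of gU, gU⁻¹ for each g in E. Being a transversal makes the union `polygon
E` of triangles a fundamental domain. By the other two properties, `polygon E` is the intersection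
of the half-planes bounded by the sides of triangles across which E does not continue
(`polygon_eq_sInter`). Half-planes are given by linear inequalities on forms, whence convexity.

Finally, `polygon E` is the closure of the interior of P₀: the extra points of P₀ lie on sides of
triangles, over vertices of type 1 and valency 1, and such vertices come from elements of order 3 in
G. -/

/-- The class of `matS`. -/
def gS : PSL(2, ℤ) := QuotientGroup.mk matS

/-- The class of `matU`. -/
def gU : PSL(2, ℤ) := QuotientGroup.mk matU

lemma neg_one_mem_center : (-1 : SL(2, ℤ)) ∈ Subgroup.center SL(2, ℤ) :=
  Subgroup.mem_center_iff.2 fun g => by simp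

lemma mk_neg_one : (QuotientGroup.mk (-1 : SL(2, ℤ)) : PSL(2, ℤ)) = 1 :=
  (QuotientGroup.eq_one_iff _).2 neg_one_mem_center

lemma gS_mul_self : gS * gS = 1 := by
  rw [← mk_neg_one]
  change QuotientGroup.mk (matS * matS) = _
  congr 1
  ext i j
  fin_cases i <;> fin_cases j <;> rfl

lemma gU_cube : gU * gU * gU = 1 := by
  rw [← mk_neg_one]
  change QuotientGroup.mk (matU * matU * matU) = _
  congr 1
  ext i j
  fin_cases i <;> fin_cases j <;> rfl

lemma gS_inv : gS⁻¹ = gS := inv_eq_of_mul_eq_one_left gS_mul_self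

lemma gU_mul_self : gU * gU = gU⁻¹ := eq_inv_of_mul_eq_one_left gU_cube

lemma gU_inv_mul_self : gU⁻¹ * gU⁻¹ = gU := by
  rw [← mul_inv_rev, gU_mul_self, inv_inv]

/-- The known generating set of the modular group is {S, T}; this relation exchanges T for U. -/
lemma mk_T : (QuotientGroup.mk ModularGroup.T : PSL(2, ℤ)) = gU⁻¹ * gS := by
  rw [← gU_mul_self]
  change QuotientGroup.mk ModularGroup.T = QuotientGroup.mk (matU * matU * matS)
  congr 1
  ext i j
  fin_cases i <;> fin_cases j <;> rfl

lemma closure_gS_mk_T :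
    Subgroup.closure {gS, (QuotientGroup.mk ModularGroup.T : PSL(2, ℤ))} = ⊤ := by
  have h := congrArg (Subgroup.map (QuotientGroup.mk' (Subgroup.center SL(2, ℤ))))
    SpecialLinearGroup.SL2Z_generators
  rw [MonoidHom.map_closure, Subgroup.map_top_of_surjective _
    (QuotientGroup.mk'_surjective _), Set.image_pair] at h
  exact h

lemma closure_gS_gU : Subgroup.closure {gS, gU} = ⊤ := by
  rw [eq_top_iff, ← closure_gS_mk_T, Subgroup.closure_le]
  have hS : gS ∈ Subgroup.closure {gS, gU} := Subgroup.subset_closure (by simp)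
  have hU : gU ∈ Subgroup.closure {gS, gU} := Subgroup.subset_closure (by simp)
  rintro g (rfl | rfl)
  · exact hS
  · rw [mk_T]; exact mul_mem (inv_mem hU) hS

lemma psl_induction_left {p : PSL(2, ℤ) → Prop} (h1 : p 1) (hS : ∀ g, p g → p (gS * g))
    (hU : ∀ g, p g → p (gU * g)) (g : PSL(2, ℤ)) : p g := by
  have hg : g ∈ Subgroup.closure {gS, gU} := closure_gS_gU ▸ Subgroup.mem_top g
  induction hg using Subgroup.closure_induction_left with
  | one => exact h1
  | mul_left x hx y _ ih => rcases hx with rfl | rfl; exacts [hS _ ih, hU _ ih]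
  | inv_mul_cancel x hx y _ ih =>
    rcases hx with rfl | rfl
    · rw [gS_inv]; exact hS _ ih
    · rw [← gU_mul_self, mul_assoc]; exact hU _ (hU _ ih)

lemma psl_induction_right {p : PSL(2, ℤ) → Prop} (h1 : p 1) (hS : ∀ g, p g → p (g * gS))
    (hU : ∀ g, p g → p (g * gU)) (g : PSL(2, ℤ)) : p g := by
  rw [← inv_inv g]
  refine psl_induction_left (p := fun g => p g⁻¹) (by simpa) (fun g h => ?_) (fun g h => ?_) g⁻¹
  · rw [mul_inv_rev, gS_inv]; exact hS _ h
  · rw [mul_inv_rev, ← gU_mul_self, ← mul_assoc]; exact hU _ (hU _ h)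

lemma gU_ne_one : gU ≠ 1 := by
  intro h
  have := Subgroup.mem_center_iff.1 ((QuotientGroup.eq_one_iff _).1 h) ModularGroup.T
  have := congrArg (fun m : SL(2, ℤ) => m 1 1) this
  exact absurd this (by decide)

lemma mem_G₀ {g : PSL(2, ℤ)} : g ∈ G₀ ↔ g = 1 ∨ g = gS := by
  constructor
  · rintro ⟨n, rfl⟩
    change gS ^ n = 1 ∨ gS ^ n = gS
    rcases Int.even_or_odd' n with ⟨k, rfl | rfl⟩
    · left; rw [zpow_mul, zpow_two, gS_mul_self, one_zpow]
    · right; rw [zpow_add_one, zpow_mul, zpow_two, gS_mul_self, one_zpow, one_mul]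
  · rintro (rfl | rfl)
    exacts [one_mem _, Subgroup.mem_zpowers _]

lemma mem_G₁ {g : PSL(2, ℤ)} : g ∈ G₁ ↔ g = 1 ∨ g = gU ∨ g = gU⁻¹ := by
  constructor
  · rintro ⟨n, rfl⟩
    change gU ^ n = 1 ∨ gU ^ n = gU ∨ gU ^ n = gU⁻¹
    have h3 : gU ^ (3 : ℤ) = 1 := by
      rw [show (3 : ℤ) = 1 + 1 + 1 by rfl, zpow_add, zpow_add, zpow_one, gU_cube]
    obtain ⟨k, hk⟩ : ∃ k : ℤ, n = 3 * k ∨ n = 3 * k + 1 ∨ n = 3 * k + (1 + 1) :=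
      ⟨n / 3, by omega⟩
    rcases hk with rfl | rfl | rfl
    · left; rw [zpow_mul, h3, one_zpow]
    · right; left; rw [zpow_add_one, zpow_mul, h3, one_zpow, one_mul]
    · right; right
      rw [zpow_add, zpow_mul, h3, one_zpow, one_mul, zpow_add, zpow_one, gU_mul_self]
  · have h : gU ∈ G₁ := Subgroup.mem_zpowers _
    rintro (rfl | rfl | rfl)
    exacts [one_mem _, h, inv_mem h]

/-! ### Formulas for the action -/

/-- The square of the absolute value. -/
def nsq (z : ℍ) : ℝ := z.re ^ 2 + z.im ^ 2

lemma nsq_pos (z : ℍ) : 0 < nsq z := by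
  have := z.im_pos
  unfold nsq; positivity

lemma re_sq_lt_nsq (z : ℍ) : z.re ^ 2 < nsq z := by
  have := z.im_pos
  unfold nsq
  have : 0 < z.im ^ 2 := by positivity
  linarith

lemma norm_sq_coe (z : ℍ) : ‖(z : ℂ)‖ ^ 2 = nsq z := by
  rw [← Complex.normSq_eq_norm_sq, Complex.normSq_apply]; simp [nsq]; ring

lemma norm_sub_one_sq (z : ℍ) : ‖(z : ℂ) - 1‖ ^ 2 = nsq z - 2 * z.re + 1 := by
  rw [← Complex.normSq_eq_norm_sq, Complex.normSq_apply]; simp [nsq]; ring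

lemma coe_gS_smul (z : ℍ) : ((gS • z : ℍ) : ℂ) = -1 / (z : ℂ) := by
  change ((matS • z : ℍ) : ℂ) = _
  rw [UpperHalfPlane.coe_specialLinearGroup_apply]
  simp [matS]

lemma coe_gU_smul (z : ℍ) : ((gU • z : ℍ) : ℂ) = 1 / (1 - z : ℂ) := by
  change ((matU • z : ℍ) : ℂ) = _
  rw [UpperHalfPlane.coe_specialLinearGroup_apply]
  simp [matU, neg_add_eq_sub]

lemma re_gS (z : ℍ) : (gS • z).re = -z.re / nsq z := by
  rw [← UpperHalfPlane.coe_re, coe_gS_smul, Complex.div_re, Complex.normSq_apply]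
  simp [nsq, sq, neg_div]

lemma im_gS (z : ℍ) : (gS • z).im = z.im / nsq z := by
  rw [← UpperHalfPlane.coe_im, coe_gS_smul, Complex.div_im, Complex.normSq_apply]
  simp [nsq, sq, neg_div]

lemma re_gU (z : ℍ) : (gU • z).re = (1 - z.re) / (nsq z - 2 * z.re + 1) := by
  rw [← UpperHalfPlane.coe_re, coe_gU_smul, Complex.div_re, Complex.normSq_apply]
  simp [nsq]; ring

lemma im_gU (z : ℍ) : (gU • z).im = z.im / (nsq z - 2 * z.re + 1) := by
  rw [← UpperHalfPlane.coe_im, coe_gU_smul, Complex.div_im, Complex.normSq_apply]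
  simp [nsq]; ring

lemma nsq_gS (z : ℍ) : nsq (gS • z) = 1 / nsq z := by
  have h := (nsq_pos z).ne'
  rw [nsq, re_gS, im_gS, div_pow, div_pow, neg_sq, ← add_div, ← nsq, div_eq_div_iff (by positivity) h]
  ring

lemma nsq_sub_pos (z : ℍ) : 0 < nsq z - 2 * z.re + 1 := by
  have := re_sq_lt_nsq z
  nlinarith [sq_nonneg (z.re - 1)]

lemma nsq_gU (z : ℍ) : nsq (gU • z) = 1 / (nsq z - 2 * z.re + 1) := by
  have h := (nsq_sub_pos z).ne'
  rw [nsq, re_gU, im_gU, div_pow, div_pow, ← add_div, div_eq_div_iff (by positivity) h, nsq]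
  ring

lemma gU_inv_smul (z : ℍ) : gU⁻¹ • z = gU • gU • z := by rw [← mul_smul, gU_mul_self]

lemma re_gU_inv (z : ℍ) : (gU⁻¹ • z).re = (nsq z - z.re) / nsq z := by
  have h := (nsq_sub_pos z).ne'
  have h' := (nsq_pos z).ne'
  rw [gU_inv_smul, re_gU, nsq_gU, re_gU, one_sub_div h]
  have e : 1 / (nsq z - 2 * z.re + 1) - 2 * ((1 - z.re) / (nsq z - 2 * z.re + 1)) + 1 =
    nsq z / (nsq z - 2 * z.re + 1) := by field_simp; ring
  rw [e, div_div_div_cancel_right₀ h]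
  ring

lemma nsq_gU_inv (z : ℍ) : nsq (gU⁻¹ • z) = (nsq z - 2 * z.re + 1) / nsq z := by
  have h := (nsq_sub_pos z).ne'
  have h' := (nsq_pos z).ne'
  rw [gU_inv_smul, nsq_gU, nsq_gU, re_gU]
  have e : 1 / (nsq z - 2 * z.re + 1) - 2 * ((1 - z.re) / (nsq z - 2 * z.re + 1)) + 1 =
    nsq z / (nsq z - 2 * z.re + 1) := by field_simp; ring
  rw [e]
  field_simp

instance : ContinuousConstSMul PSL(2, ℤ) ℍ where
  continuous_const_smul g := by
    induction g using QuotientGroup.induction_on with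
    | H g => exact continuous_const_smul (Matrix.SpecialLinearGroup.map (Int.castRingHom ℝ) g)

lemma continuous_nsq : Continuous nsq := by unfold nsq; fun_prop

/-! ### The triangle and its translates -/

lemma mem_triangle {z : ℍ} : z ∈ triangle ↔ 0 ≤ z.re ∧ z.re ≤ 1 / 2 ∧ 2 * z.re ≤ nsq z := by
  have h := norm_sub_one_sq z
  have h0 := norm_nonneg ((z : ℂ) - 1)
  simp only [triangle, Set.mem_ofPred_eq]
  refine and_congr_right fun _ => and_congr_right fun _ => ⟨fun h1 => ?_, fun h1 => ?_⟩ <;> nlinarith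

lemma mem_cornerSides {z : ℍ} :
    z ∈ cornerSides ↔ z ∈ triangle ∧ (z.re = 1 / 2 ∨ nsq z = 2 * z.re) := by
  have h := norm_sub_one_sq z
  have h0 := norm_nonneg ((z : ℂ) - 1)
  simp only [cornerSides, Set.mem_ofPred_eq]
  refine and_congr_right fun _ => or_congr_right ⟨fun h1 => ?_, fun h1 => ?_⟩
  · rw [h1] at h; linarith
  · nlinarith

lemma isClosed_triangle : IsClosed triangle := by
  have : triangle = {z : ℍ | 0 ≤ z.re} ∩ ({z : ℍ | z.re ≤ 1 / 2} ∩ {z : ℍ | 2 * z.re ≤ nsq z}) := by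
    ext z; exact mem_triangle
  rw [this]
  have := continuous_nsq
  exact (isClosed_le (by fun_prop) (by fun_prop)).inter
    ((isClosed_le (by fun_prop) (by fun_prop)).inter (isClosed_le (by fun_prop) (by fun_prop)))

/-- Reduced words: `Reduced false h` (resp. `Reduced true h`) means that `h` is an alternating
product of `gS` and of powers of `gU` that starts with `gS` (resp. with a power of `gU`). -/
inductive Reduced : Bool → PSL(2, ℤ) → Prop
  | S : Reduced false gS
  | U : Reduced true gU
  | U_inv : Reduced true gU⁻¹
  | S_mul {h} : Reduced true h → Reduced false (gS * h)
  | U_mul {h} : Reduced false h → Reduced true (gU * h)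
  | U_inv_mul {h} : Reduced false h → Reduced true (gU⁻¹ * h)

/-- Multiplying on the left by a generator prepends a syllable, or modifies or cancels the first
one. -/
lemma eq_one_or_reduced (h : PSL(2, ℤ)) : h = 1 ∨ Reduced false h ∨ Reduced true h := by
  refine psl_induction_left (p := fun h => h = 1 ∨ Reduced false h ∨ Reduced true h)
    (Or.inl rfl) (fun g hg => ?_) (fun g hg => ?_) h
  · rcases hg with rfl | hg | hg
    · rw [mul_one]; exact Or.inr (Or.inl .S)
    · cases hg with
      | S => exact Or.inl gS_mul_self
      | S_mul hw => rw [← mul_assoc, gS_mul_self, one_mul]; exact Or.inr (Or.inr hw)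
    · exact Or.inr (Or.inl (.S_mul hg))
  · rcases hg with rfl | hg | hg
    · rw [mul_one]; exact Or.inr (Or.inr .U)
    · exact Or.inr (Or.inr (.U_mul hg))
    · cases hg with
      | U => rw [gU_mul_self]; exact Or.inr (Or.inr .U_inv)
      | U_inv => exact Or.inl (mul_inv_cancel _)
      | U_mul hw => rw [← mul_assoc, gU_mul_self]; exact Or.inr (Or.inr (.U_inv_mul hw))
      | U_inv_mul hw => rw [mul_inv_cancel_left]; exact Or.inr (Or.inl hw)

/-- Reduced words are built from the left, but paths in 𝐓 grow on the right. A change at the right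
end leaves the type of the first syllable alone, unless the word consists of just that syllable. -/
lemma Reduced.mul_right {b : Bool} {h : PSL(2, ℤ)} (hh : Reduced b h) :
    (Reduced b (h * gS) ∨ b = false ∧ h = gS) ∧
    ∀ k, k = gU ∨ k = gU⁻¹ → Reduced b (h * k) ∨ b = true ∧ (h = gU ∨ h = gU⁻¹) := by
  induction hh with
  | S =>
    refine ⟨by simp, ?_⟩
    rintro k (rfl | rfl)
    exacts [Or.inl (.S_mul .U), Or.inl (.S_mul .U_inv)]
  | U => exact ⟨Or.inl (.U_mul .S), by simp⟩
  | U_inv => exact ⟨Or.inl (.U_inv_mul .S), by simp⟩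
  | S_mul hw ih =>
    refine ⟨Or.inl ?_, fun k hk => Or.inl ?_⟩
    · rw [mul_assoc]; exact .S_mul (by simpa using ih.1)
    · rw [mul_assoc]
      rcases ih.2 k hk with h1 | ⟨-, h1⟩
      · exact .S_mul h1
      · rcases hk with rfl | rfl <;> rcases h1 with rfl | rfl
        · rw [gU_mul_self]; exact .S_mul .U_inv
        · rw [inv_mul_cancel, mul_one]; exact .S
        · rw [mul_inv_cancel, mul_one]; exact .S
        · rw [gU_inv_mul_self]; exact .S_mul .U
  | U_mul hw ih =>
    refine ⟨Or.inl ?_, fun k hk => Or.inl ?_⟩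
    · rw [mul_assoc]
      rcases ih.1 with h1 | ⟨-, rfl⟩
      · exact .U_mul h1
      · rw [gS_mul_self, mul_one]; exact .U
    · rw [mul_assoc]; exact .U_mul (by simpa using ih.2 k hk)
  | U_inv_mul hw ih =>
    refine ⟨Or.inl ?_, fun k hk => Or.inl ?_⟩
    · rw [mul_assoc]
      rcases ih.1 with h1 | ⟨-, rfl⟩
      · exact .U_inv_mul h1
      · rw [gS_mul_self, mul_one]; exact .U_inv
    · rw [mul_assoc]; exact .U_inv_mul (by simpa using ih.2 k hk)

/-- The region that contains `h • triangle` for all reduced words `h` of the given type. -/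
def side : Bool → Set ℍ
  | false => {z | z.re ≤ 0}
  | true => {z | nsq z ≤ 2 * z.re ∧ nsq z ≤ 1 ∨ 1 / 2 ≤ z.re ∧ 1 ≤ nsq z}

lemma gU_smul_mem_side {z : ℍ} (h1 : z.re ≤ 1 / 2) (h2 : 2 * z.re ≤ nsq z) :
    gU • z ∈ side true := by
  left
  have h := nsq_sub_pos z
  rw [nsq_gU, re_gU, ← mul_div_assoc, div_le_div_iff_of_pos_right h, div_le_one h]
  constructor <;> linarith

lemma gU_inv_smul_mem_side {z : ℍ} (h1 : z.re ≤ 1 / 2) (h2 : 2 * z.re ≤ nsq z) :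
    gU⁻¹ • z ∈ side true := by
  right
  have h := nsq_pos z
  rw [nsq_gU_inv, re_gU_inv, le_div_iff₀ h, le_div_iff₀ h]
  constructor <;> linarith

lemma gS_smul_mem_side {z : ℍ} (h : 0 ≤ z.re) : gS • z ∈ side false := by
  change (gS • z).re ≤ 0
  rw [re_gS, neg_div, Left.neg_nonpos_iff]
  exact div_nonneg h (nsq_pos z).le

lemma re_pos_of_mem_side {z : ℍ} (h : z ∈ side true) : 0 < z.re := by
  have := nsq_pos z
  rcases h with h | h <;> linarith [h.1]

lemma wedge_of_mem_side {z : ℍ} (h : z ∈ side false) : z.re ≤ 1 / 2 ∧ 2 * z.re ≤ nsq z := by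
  have := nsq_pos z
  change z.re ≤ 0 at h
  constructor <;> linarith

/-- Ping-pong: `side true` lies in the right half-plane, which S sends to `side false`; `side false`
lies in the wedge at `corner`, which U and U⁻¹ send to `side true`. -/
lemma Reduced.smul_mem_side {b : Bool} {h : PSL(2, ℤ)} (hh : Reduced b h) {z : ℍ}
    (hz : z ∈ triangle) : h • z ∈ side b := by
  rw [mem_triangle] at hz
  induction hh with
  | S => exact gS_smul_mem_side hz.1
  | U => exact gU_smul_mem_side hz.2.1 hz.2.2
  | U_inv => exact gU_inv_smul_mem_side hz.2.1 hz.2.2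
  | S_mul hw ih => rw [mul_smul]; exact gS_smul_mem_side (re_pos_of_mem_side ih).le
  | U_mul hw ih =>
    rw [mul_smul]; exact gU_smul_mem_side (wedge_of_mem_side ih).1 (wedge_of_mem_side ih).2
  | U_inv_mul hw ih =>
    rw [mul_smul]; exact gU_inv_smul_mem_side (wedge_of_mem_side ih).1 (wedge_of_mem_side ih).2

lemma mem_cornerSides_of_mem_side {z : ℍ} (hz : z ∈ triangle) (h : z ∈ side true) :
    z ∈ cornerSides := by
  refine mem_cornerSides.2 ⟨hz, ?_⟩
  rw [mem_triangle] at hz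
  rcases h with h | h
  · right; linarith [h.1]
  · left; linarith [h.1]

lemma inv_smul_re_eq_zero {w z : ℍ} (h : w = gS • z) (hw : w.re = 0) : z.re = 0 := by
  rw [h, re_gS, div_eq_zero_iff, neg_eq_zero] at hw
  exact hw.resolve_right (nsq_pos z).ne'

/-- This excludes words of at least two syllables from `triangle_inter`: the half-plane Re z ≤ 0
lies strictly inside the wedge, so its image under U misses even the boundary of the triangle. -/
lemma gU_smul_notMem {z : ℍ} (h : z ∈ side false) : gU • z ∉ triangle := by
  have h0 := nsq_sub_pos z
  have h1 := nsq_pos z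
  change z.re ≤ 0 at h
  rw [mem_triangle, nsq_gU, re_gU, ← mul_div_assoc, div_le_div_iff_of_pos_right h0,
    div_le_iff₀ h0]
  rintro ⟨-, h2, h3⟩
  linarith

lemma gU_inv_smul_notMem {z : ℍ} (h : z ∈ side false) : gU⁻¹ • z ∉ triangle := by
  have h1 := nsq_pos z
  change z.re ≤ 0 at h
  rw [mem_triangle, re_gU_inv, div_le_iff₀ h1]
  rintro ⟨-, h2, h3⟩
  linarith

/-- The intersections of the triangle with its translates. -/
lemma triangle_inter {k : PSL(2, ℤ)} {z : ℍ} (hz : z ∈ triangle) (hk : k⁻¹ • z ∈ triangle) :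
    k = 1 ∨ k = gS ∧ z.re = 0 ∨ (k = gU ∨ k = gU⁻¹) ∧ z ∈ cornerSides := by
  have hzk : z = k • k⁻¹ • z := (smul_inv_smul k z).symm
  rcases eq_one_or_reduced k with rfl | hr | hr
  · exact Or.inl rfl
  · right; left
    have hs := hr.smul_mem_side hk
    rw [smul_inv_smul] at hs
    have h0 : z.re = 0 := le_antisymm hs (mem_triangle.1 hz).1
    refine ⟨?_, h0⟩
    generalize hb : false = b at hr
    cases hr with
    | S => rfl
    | S_mul hw =>
      have h1 := hw.smul_mem_side hk
      rw [mul_smul] at hzk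
      exact absurd (inv_smul_re_eq_zero hzk h0) (re_pos_of_mem_side h1).ne'
    | _ => cases hb
  · right; right
    have hs := hr.smul_mem_side hk
    rw [smul_inv_smul] at hs
    refine ⟨?_, mem_cornerSides_of_mem_side hz hs⟩
    generalize hb : true = b at hr
    cases hr with
    | U => exact Or.inl rfl
    | U_inv => exact Or.inr rfl
    | U_mul hw =>
      have h1 := hw.smul_mem_side hk
      rw [mul_smul] at hzk
      exact absurd (hzk ▸ hz) (gU_smul_notMem h1)
    | U_inv_mul hw =>
      have h1 := hw.smul_mem_side hk
      rw [mul_smul] at hzk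
      exact absurd (hzk ▸ hz) (gU_inv_smul_notMem h1)
    | _ => cases hb

lemma mem_smul_triangle {g : PSL(2, ℤ)} {z : ℍ} : z ∈ g • triangle ↔ g⁻¹ • z ∈ triangle :=
  Set.mem_smul_set_iff_inv_smul_mem

lemma gS_smul_mem_triangle {z : ℍ} (h1 : z.re ≤ 0) (h2 : -(1 / 2) ≤ z.re)
    (h3 : -(2 * z.re) ≤ nsq z) : gS • z ∈ triangle := by
  have h := nsq_pos z
  rw [mem_triangle, re_gS, nsq_gS, ← mul_div_assoc, div_le_div_iff_of_pos_right h, div_le_iff₀ h]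
  exact ⟨div_nonneg (by linarith) h.le, by linarith, by linarith⟩

/-- The right half of the standard fundamental domain |Re z| ≤ 1/2, |z| ≥ 1 lies in the triangle,
and S moves the left half into it. -/
lemma exists_mem_smul_triangle (z : ℍ) : ∃ g : PSL(2, ℤ), z ∈ g • triangle := by
  obtain ⟨g, h1, h2⟩ := ModularGroup.exists_smul_mem_fd z
  set w := g • z with hw
  have hN : 1 ≤ nsq w := by rw [← norm_sq_coe, ← Complex.normSq_eq_norm_sq]; exact h1
  rw [abs_le] at h2
  rcases le_total 0 w.re with h | h
  · exact ⟨(QuotientGroup.mk g)⁻¹, by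
      rw [mem_smul_triangle, inv_inv, mk_smul, ← hw, mem_triangle]
      exact ⟨h, h2.2, by linarith⟩⟩
  · exact ⟨(gS * QuotientGroup.mk g)⁻¹, by
      rw [mem_smul_triangle, inv_inv, mul_smul, mk_smul, ← hw]
      exact gS_smul_mem_triangle h h2.1 (by linarith)⟩

/-- A neighbourhood of the triangle that is contained in the union of four translates. -/
def nearTriangle : Set ℍ := {z | -(1 / 2) < z.re ∧ z.re < 1 ∧ -(2 * z.re) < nsq z ∧ z.re < nsq z}

lemma isOpen_nearTriangle : IsOpen nearTriangle := by
  have := continuous_nsq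
  simp only [nearTriangle, Set.ofPred_and]
  refine (isOpen_lt ?_ ?_).inter ((isOpen_lt ?_ ?_).inter ((isOpen_lt ?_ ?_).inter
    (isOpen_lt ?_ ?_))) <;> fun_prop

lemma triangle_subset_nearTriangle : triangle ⊆ nearTriangle := by
  intro z hz
  have h := nsq_pos z
  rw [mem_triangle] at hz
  refine ⟨by linarith, by linarith, by linarith, ?_⟩
  rcases hz.1.eq_or_lt with h0 | h0 <;> linarith

/-- The inequalities defining `nearTriangle` come from the outer sides of the three neighbours: Re z
= -1/2 and |z|² = -2 Re z bound S△, while |z|² = Re z and Re z = 1 are the images of the imaginary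
axis under U and U⁻¹. -/
lemma nearTriangle_subset {z : ℍ} (hz : z ∈ nearTriangle) :
    ∃ k ∈ ({1, gS, gU, gU⁻¹} : Set PSL(2, ℤ)), z ∈ k • triangle := by
  obtain ⟨h1, h2, h3, h4⟩ := hz
  have hN := nsq_pos z
  have hM := nsq_sub_pos z
  rcases le_total z.re 0 with h0 | h0
  · refine ⟨gS, by simp, ?_⟩
    rw [mem_smul_triangle, gS_inv]
    exact gS_smul_mem_triangle h0 h1.le h3.le
  · by_cases hA : z.re ≤ 1 / 2 ∧ 2 * z.re ≤ nsq z
    · exact ⟨1, by simp, by rw [one_smul, mem_triangle]; exact ⟨h0, hA⟩⟩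
    · by_cases hB : 1 / 2 ≤ z.re ∧ 1 ≤ nsq z
      · refine ⟨gU⁻¹, by simp, ?_⟩
        rw [mem_smul_triangle, inv_inv, mem_triangle, re_gU, nsq_gU, ← mul_div_assoc,
          div_le_div_iff_of_pos_right hM, div_le_iff₀ hM]
        exact ⟨div_nonneg (by linarith) hM.le, by linarith, by linarith⟩
      · refine ⟨gU, by simp, ?_⟩
        rw [mem_smul_triangle, mem_triangle, re_gU_inv, nsq_gU_inv, ← mul_div_assoc,
          div_le_div_iff_of_pos_right hN, div_le_iff₀ hN]
        have key : nsq z ≤ 2 * z.re ∧ nsq z ≤ 1 := by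
          rw [not_and_or, not_le, not_le] at hA hB
          rcases hA with hA | hA <;> rcases hB with hB | hB <;> constructor <;> linarith
        exact ⟨div_nonneg (by linarith) hN.le, by linarith, by linarith⟩

/-- The elements that take the triangle to itself or to one of its neighbours. -/
def nbrs : Set PSL(2, ℤ) := {1, gS, gU, gU⁻¹}

lemma finite_nbrs : nbrs.Finite := by simp [nbrs]

lemma mem_nbrs_of_inter {g h : PSL(2, ℤ)} {z : ℍ} (hg : z ∈ g • triangle)
    (hh : z ∈ h • triangle) : g⁻¹ * h ∈ nbrs := by
  rw [mem_smul_triangle] at hg hh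
  have := triangle_inter (k := g⁻¹ * h) hg (by simpa [mul_smul] using hh)
  simp only [nbrs, Set.mem_insert_iff, Set.mem_singleton_iff]
  tauto

/-- A translate that meets g • `nearTriangle` shares a point with some gk△, k in `nbrs`, so it is
gkk'△ with k' in `nbrs` as well. -/
lemma locallyFinite_triangle : LocallyFinite fun g : PSL(2, ℤ) => g • triangle := by
  intro z
  obtain ⟨g, hg⟩ := exists_mem_smul_triangle z
  refine ⟨g • nearTriangle, ?_, ?_⟩
  · exact (isOpen_nearTriangle.smul g).mem_nhds
      (Set.smul_set_mono triangle_subset_nearTriangle hg)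
  · refine (((finite_nbrs.mul finite_nbrs).smul_set (a := g))).subset ?_
    rintro h ⟨w, hw, hw'⟩
    obtain ⟨k, hk, hwk⟩ := nearTriangle_subset (Set.mem_smul_set_iff_inv_smul_mem.1 hw')
    have h1 : w ∈ (g * k) • triangle := by
      rw [mul_smul]; exact Set.mem_smul_set_iff_inv_smul_mem.2 hwk
    have h2 := mem_nbrs_of_inter h1 hw
    refine ⟨k * ((g * k)⁻¹ * h), Set.mul_mem_mul hk h2, ?_⟩
    simp [smul_eq_mul, mul_assoc]


/-! ### Half-planes and convexity -/

lemma cosh_dist_eq (z w : ℍ) :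
    Real.cosh (dist z w) = (nsq z + nsq w - 2 * z.re * w.re) / (2 * z.im * w.im) := by
  have h1 := z.im_ne_zero
  have h2 := w.im_ne_zero
  rw [UpperHalfPlane.cosh_dist', eq_div_iff (by positivity), nsq, nsq]
  field_simp
  ring

/-- In the space of binary quadratic forms, a point of a geodesic segment is a non-negative
combination of the end points. -/
lemma geodesicSegment_combination {z w x : ℍ} (hx : x ∈ geodesicSegment z w) (a b c : ℝ) :
    Real.sinh (dist z w) * ((a * nsq x + b * x.re + c) / x.im) =
      Real.sinh (dist x w) * ((a * nsq z + b * z.re + c) / z.im) +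
      Real.sinh (dist z x) * ((a * nsq w + b * w.re + c) / w.im) := by
  have hd : dist z w = dist z x + dist x w := Eq.symm hx
  have hs := Real.sinh_add (dist z x) (dist x w)
  have hc := Real.cosh_add (dist z x) (dist x w)
  have e1 := Real.cosh_sq (dist z x)
  have e2 := Real.cosh_sq (dist x w)
  rw [← hd] at hs hc
  have h1 := cosh_dist_eq z x
  have h2 := cosh_dist_eq x w
  have h3 := cosh_dist_eq z w
  generalize Real.sinh (dist z w) = s at *
  generalize Real.sinh (dist z x) = s₁ at *
  generalize Real.sinh (dist x w) = s₂ at *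
  generalize Real.cosh (dist z w) = k at *
  generalize Real.cosh (dist z x) = k₁ at *
  generalize Real.cosh (dist x w) = k₂ at *
  -- The hyperboloid model: v becomes the form (A, B, C) with AC - B² = 1, and cosh of the distance
  -- is the polarisation of this determinant.
  have form : ∀ v : ℍ, ∃ A B C : ℝ, 0 < A ∧ A * C - B ^ 2 = 1 ∧ 1 / v.im = A ∧ v.re / v.im = B ∧
      nsq v / v.im = C := fun v => by
    refine ⟨_, _, _, one_div_pos.2 v.im_pos, ?_, rfl, rfl, rfl⟩
    have := v.im_ne_zero
    field_simp
    rw [nsq]; ring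
  obtain ⟨A, B, C, hA, hq, hA', hB', hC'⟩ := form x
  obtain ⟨A₁, B₁, C₁, -, hq₁, hA₁, hB₁, hC₁⟩ := form z
  obtain ⟨A₂, B₂, C₂, -, hq₂, hA₂, hB₂, hC₂⟩ := form w
  have exp : ∀ v v' : ℍ, (nsq v + nsq v' - 2 * v.re * v'.re) / (2 * v.im * v'.im) =
      ((1 / v.im) * (nsq v' / v'.im) + (1 / v'.im) * (nsq v / v.im) -
        2 * (v.re / v.im) * (v'.re / v'.im)) / 2 := fun v v' => by
    have := v.im_ne_zero
    have := v'.im_ne_zero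
    field_simp; ring
  have lin : ∀ v : ℍ, (a * nsq v + b * v.re + c) / v.im =
      a * (nsq v / v.im) + b * (v.re / v.im) + c * (1 / v.im) := fun v => by ring
  rw [exp, hA', hB', hC', hA₁, hB₁, hC₁] at h1
  rw [exp, hA', hB', hC', hA₂, hB₂, hC₂] at h2
  rw [exp, hA₁, hB₁, hC₁, hA₂, hB₂, hC₂] at h3
  rw [lin, lin, lin, hA', hB', hC', hA₁, hB₁, hC₁, hA₂, hB₂, hC₂]
  clear hx lin exp form hA' hB' hC' hA₁ hB₁ hC₁ hA₂ hB₂ hC₂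
  -- The difference (α, β, γ) of the two sides is orthogonal to the form of x (`o1`) and isotropic
  -- (`o2`). The orthogonal complement of a positive form is negative definite, so the difference
  -- vanishes; `o3` makes this explicit by eliminating γ.
  obtain ⟨α, hα⟩ : ∃ α, α = s * A - s₂ * A₁ - s₁ * A₂ := ⟨_, rfl⟩
  obtain ⟨β, hβ⟩ : ∃ β, β = s * B - s₂ * B₁ - s₁ * B₂ := ⟨_, rfl⟩
  obtain ⟨γ, hγ⟩ : ∃ γ, γ = s * C - s₂ * C₁ - s₁ * C₂ := ⟨_, rfl⟩
  have o1 : α * C + γ * A - 2 * β * B = 0 := by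
    have : α * C + γ * A - 2 * β * B = 2 * s * (A * C - B ^ 2) - 2 * s₂ * k₁ - 2 * s₁ * k₂ := by
      rw [hα, hβ, hγ, h1, h2]; ring
    rw [this, hq, hs]; ring
  have o2 : α * γ - β ^ 2 = 0 := by
    have : α * γ - β ^ 2 = s ^ 2 * (A * C - B ^ 2) + s₂ ^ 2 * (A₁ * C₁ - B₁ ^ 2) +
        s₁ ^ 2 * (A₂ * C₂ - B₂ ^ 2) - 2 * s * s₂ * k₁ - 2 * s * s₁ * k₂ + 2 * s₁ * s₂ * k := by
      rw [hα, hβ, hγ, h1, h2, h3]; ring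
    rw [this, hq, hq₁, hq₂, hc, hs]
    linear_combination -s₂ ^ 2 * e1 - s₁ ^ 2 * e2
  have o3 : α ^ 2 + (α * B - β * A) ^ 2 = 0 := by
    linear_combination A * α * o1 - α ^ 2 * hq - A ^ 2 * o2
  have hα0 : α = 0 := by nlinarith [sq_nonneg α, sq_nonneg (α * B - β * A)]
  have hβ0 : β = 0 := by
    rw [hα0] at o2; nlinarith [sq_nonneg β]
  have hγ0 : γ = 0 := by
    rw [hα0, hβ0] at o1
    simpa [hA.ne'] using o1
  linear_combination a * (hγ0 - hγ) + b * (hβ0 - hβ) + c * (hα0 - hα)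

/-- A half-plane is where a linear functional of the form is nonnegative, and
`geodesicSegment_combination` has nonnegative coefficients. -/
lemma IsClosedHalfPlane.isGeodesicallyConvex {H : Set ℍ} (hH : IsClosedHalfPlane H) :
    IsGeodesicallyConvex H := by
  obtain ⟨a, b, c, -, rfl⟩ := hH
  intro z hz w hw x hx
  simp only [Set.mem_ofPred_eq, norm_sq_coe] at hz hw ⊢
  rcases eq_or_ne z w with rfl | hne
  · have hd : dist z x = 0 := by
      have h : dist z x + dist x z = dist z z := hx
      rw [dist_self] at h
      linarith [dist_nonneg (x := z) (y := x), dist_nonneg (x := x) (y := z)]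
    rwa [← dist_eq_zero.1 hd]
  · have key := geodesicSegment_combination hx a b c
    have hs := Real.sinh_pos_iff.2 (dist_pos.2 hne)
    have h0 : 0 ≤ (a * nsq x + b * x.re + c) / x.im := by
      refine nonneg_of_mul_nonneg_right (a := Real.sinh (dist z w)) ?_ hs
      rw [key]
      exact add_nonneg
        (mul_nonneg (Real.sinh_nonneg_iff.2 dist_nonneg) (div_nonneg hz z.im_pos.le))
        (mul_nonneg (Real.sinh_nonneg_iff.2 dist_nonneg) (div_nonneg hw w.im_pos.le))
    simpa [div_mul_cancel₀ _ x.im_ne_zero] using mul_nonneg h0 x.im_pos.le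

lemma isGeodesicallyConvex_sInter {𝓗 : Set (Set ℍ)} (h : ∀ H ∈ 𝓗, IsClosedHalfPlane H) :
    IsGeodesicallyConvex (⋂₀ 𝓗) := fun z hz w hw _ hx H hH =>
  (h H hH).isGeodesicallyConvex z (hz H hH) w (hw H hH) hx

lemma IsClosedHalfPlane.smul {H : Set ℍ} (hH : IsClosedHalfPlane H) (g : PSL(2, ℤ)) :
    IsClosedHalfPlane (g • H) := by
  refine psl_induction_left (p := fun g => IsClosedHalfPlane (g • H)) ?_ (fun g hg => ?_)
    (fun g hg => ?_) g
  · rwa [one_smul]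
  · obtain ⟨a, b, c, h, hg⟩ := hg
    refine ⟨c, -b, a, by linarith, ?_⟩
    rw [mul_smul, hg]
    ext z
    have hN := nsq_pos z
    rw [Set.mem_smul_set_iff_inv_smul_mem, gS_inv]
    simp only [Set.mem_ofPred_eq, norm_sq_coe, nsq_gS, re_gS]
    have : a * (1 / nsq z) + b * (-z.re / nsq z) + c = (c * nsq z + -b * z.re + a) / nsq z := by
      field_simp; ring
    rw [this, le_div_iff₀ hN, zero_mul]
  · obtain ⟨a, b, c, h, hg⟩ := hg
    refine ⟨a + b + c, -2 * a - b, a, by linarith, ?_⟩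
    rw [mul_smul, hg]
    ext z
    have hN := nsq_pos z
    rw [Set.mem_smul_set_iff_inv_smul_mem]
    simp only [Set.mem_ofPred_eq, norm_sq_coe, nsq_gU_inv, re_gU_inv]
    have : a * ((nsq z - 2 * z.re + 1) / nsq z) + b * ((nsq z - z.re) / nsq z) + c =
        ((a + b + c) * nsq z + (-2 * a - b) * z.re + a) / nsq z := by
      field_simp; ring
    rw [this, le_div_iff₀ hN, zero_mul]

/-! ### An equivariant convex structure on the hyperbolic plane -/

/-- The coefficients of the convex combination of the quadratic forms that correspond to two
points. -/
def mixCoeff (f : ℍ → ℝ) (t : unitInterval) (z w : ℍ) : ℝ :=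
  (1 - t) * (f z / z.im) + t * (f w / w.im)

lemma mixCoeff_one_pos (t : unitInterval) (z w : ℍ) : 0 < mixCoeff 1 t z w := by
  have h1 : 0 < 1 / z.im := one_div_pos.2 z.im_pos
  have h2 : 0 < 1 / w.im := one_div_pos.2 w.im_pos
  simp only [mixCoeff, Pi.one_apply]
  rcases t.2.1.eq_or_lt with h | h
  · simpa [← h] using h1
  · have := t.2.2
    have := mul_pos h h2
    have := mul_nonneg (sub_nonneg.2 t.2.2) h1.le
    linarith

/-- The discriminant of the convex combination. -/
def mixDisc (t : unitInterval) (z w : ℍ) : ℝ :=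
  mixCoeff 1 t z w * mixCoeff nsq t z w - mixCoeff UpperHalfPlane.re t z w ^ 2

lemma mixDisc_pos (t : unitInterval) (z w : ℍ) : 0 < mixDisc t z w := by
  have h1 := z.im_ne_zero
  have h2 := w.im_ne_zero
  -- The determinant of the combination is (1 - t)² + t² + 2t(1 - t) cosh d(z, w).
  have key : mixDisc t z w = (1 - 2 * t * (1 - t)) + t * (1 - t) *
      (((z.re - w.re) ^ 2 + z.im ^ 2 + w.im ^ 2) / (z.im * w.im)) := by
    simp only [mixDisc, mixCoeff, Pi.one_apply, nsq]
    field_simp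
    ring
  have h3 : (0 : ℝ) ≤ t * (1 - t) := mul_nonneg t.2.1 (sub_nonneg.2 t.2.2)
  have h4 : 0 ≤ ((z.re - w.re) ^ 2 + z.im ^ 2 + w.im ^ 2) / (z.im * w.im) := by
    have := z.im_pos
    have := w.im_pos
    positivity
  rw [key]
  nlinarith [mul_nonneg h3 h4, sq_nonneg ((t : ℝ) - 1 / 2)]

/-- The point that corresponds to a convex combination of the quadratic forms that correspond to
`z` and `w`. -/
def mix (t : unitInterval) (z w : ℍ) : ℍ :=
  ⟨⟨mixCoeff UpperHalfPlane.re t z w / mixCoeff 1 t z w, √(mixDisc t z w) / mixCoeff 1 t z w⟩,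
    div_pos (Real.sqrt_pos.2 (mixDisc_pos t z w)) (mixCoeff_one_pos t z w)⟩

lemma re_mix (t : unitInterval) (z w : ℍ) :
    (mix t z w).re = mixCoeff UpperHalfPlane.re t z w / mixCoeff 1 t z w := rfl

lemma im_mix (t : unitInterval) (z w : ℍ) :
    (mix t z w).im = √(mixDisc t z w) / mixCoeff 1 t z w := rfl

lemma nsq_mix (t : unitInterval) (z w : ℍ) :
    nsq (mix t z w) = mixCoeff nsq t z w / mixCoeff 1 t z w := by
  have h := (mixCoeff_one_pos t z w).ne'
  rw [nsq, re_mix, im_mix, div_pow, div_pow, Real.sq_sqrt (mixDisc_pos t z w).le, mixDisc]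
  field_simp
  ring

lemma ext_re_im {z w : ℍ} (h1 : z.re = w.re) (h2 : z.im = w.im) : z = w :=
  UpperHalfPlane.ext (Complex.ext h1 h2)

lemma mix_zero (z w : ℍ) : mix 0 z w = z := by
  have h := z.im_ne_zero
  have hD : mixDisc 0 z w = 1 := by
    simp [mixDisc, mixCoeff]; field_simp; rw [nsq]; ring
  refine ext_re_im ?_ ?_
  · rw [re_mix]; simp [mixCoeff]; field_simp
  · rw [im_mix, hD]; simp [mixCoeff]

lemma mix_one (z w : ℍ) : mix 1 z w = w := by
  have h := w.im_ne_zero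
  have hD : mixDisc 1 z w = 1 := by
    simp [mixDisc, mixCoeff]; field_simp; rw [nsq]; ring
  refine ext_re_im ?_ ?_
  · rw [re_mix]; simp [mixCoeff]; field_simp
  · rw [im_mix, hD]; simp [mixCoeff]

lemma mix_gS (t : unitInterval) (z w : ℍ) : mix t (gS • z) (gS • w) = gS • mix t z w := by
  have e1 : mixCoeff 1 t (gS • z) (gS • w) = mixCoeff nsq t z w := by
    simp [mixCoeff, im_gS]
  have e2 : mixCoeff nsq t (gS • z) (gS • w) = mixCoeff 1 t z w := by
    have h1 := nsq_pos z
    have h2 := nsq_pos w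
    simp only [mixCoeff, im_gS, nsq_gS, div_div_div_cancel_right₀ h1.ne',
      div_div_div_cancel_right₀ h2.ne', Pi.one_apply]
  have e3 : mixCoeff UpperHalfPlane.re t (gS • z) (gS • w) = -mixCoeff UpperHalfPlane.re t z w := by
    have h1 := nsq_pos z
    have h2 := nsq_pos w
    simp only [mixCoeff, im_gS, re_gS, div_div_div_cancel_right₀ h1.ne',
      div_div_div_cancel_right₀ h2.ne']
    ring
  have hD : mixDisc t (gS • z) (gS • w) = mixDisc t z w := by
    rw [mixDisc, e1, e2, e3, mixDisc]; ring
  have h := (mixCoeff_one_pos t z w).ne'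
  refine ext_re_im ?_ ?_
  · rw [re_gS, re_mix, re_mix, nsq_mix, e1, e3, ← neg_div, div_div_div_cancel_right₀ h]
  · rw [im_gS, im_mix, im_mix, nsq_mix, e1, hD, div_div_div_cancel_right₀ h]

lemma mix_T (t : unitInterval) (z w : ℍ) :
    mix t (ModularGroup.T • z) (ModularGroup.T • w) = ModularGroup.T • mix t z w := by
  have e1 : mixCoeff 1 t (ModularGroup.T • z) (ModularGroup.T • w) = mixCoeff 1 t z w := by
    simp only [mixCoeff, ModularGroup.im_T_smul, Pi.one_apply]
  have e3 : mixCoeff UpperHalfPlane.re t (ModularGroup.T • z) (ModularGroup.T • w) =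
      mixCoeff UpperHalfPlane.re t z w + mixCoeff 1 t z w := by
    simp only [mixCoeff, ModularGroup.im_T_smul, ModularGroup.re_T_smul, Pi.one_apply]; ring
  have e2 : mixCoeff nsq t (ModularGroup.T • z) (ModularGroup.T • w) =
      mixCoeff nsq t z w + 2 * mixCoeff UpperHalfPlane.re t z w + mixCoeff 1 t z w := by
    simp only [mixCoeff, nsq, ModularGroup.im_T_smul, ModularGroup.re_T_smul, Pi.one_apply]; ring
  have hD : mixDisc t (ModularGroup.T • z) (ModularGroup.T • w) = mixDisc t z w := by
    rw [mixDisc, e1, e2, e3, mixDisc]; ring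
  have h := (mixCoeff_one_pos t z w).ne'
  refine ext_re_im ?_ ?_
  · rw [ModularGroup.re_T_smul, re_mix, re_mix, e1, e3]; field_simp
  · rw [ModularGroup.im_T_smul, im_mix, im_mix, e1, hD]

/-- Γ acts linearly on forms and preserves the determinant, so it commutes with normalised
combinations; S and T suffice for the check. -/
lemma mix_smul (g : PSL(2, ℤ)) (t : unitInterval) (z w : ℍ) :
    mix t (g • z) (g • w) = g • mix t z w := by
  have hg : g ∈ Subgroup.closure {gS, (QuotientGroup.mk ModularGroup.T : PSL(2, ℤ))} :=
    closure_gS_mk_T ▸ Subgroup.mem_top g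
  induction hg using Subgroup.closure_induction generalizing z w with
  | mem x hx =>
    rcases hx with rfl | rfl
    exacts [mix_gS t z w, mix_T t z w]
  | one => simp
  | mul x y _ _ hx hy => rw [mul_smul, mul_smul, hx, hy, mul_smul]
  | inv x _ hx =>
    rw [eq_inv_smul_iff, ← hx, smul_inv_smul, smul_inv_smul]

lemma continuous_mix {X : Type*} [TopologicalSpace X] {t : X → unitInterval} {z w : X → ℍ}
    (ht : Continuous t) (hz : Continuous z) (hw : Continuous w) :
    Continuous fun x => mix (t x) (z x) (w x) := by
  have hN := continuous_nsq
  have hc : ∀ f : ℍ → ℝ, Continuous f → Continuous fun x => mixCoeff f (t x) (z x) (w x) := by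
    intro f hf
    unfold mixCoeff
    have h1 := fun x => (z x).im_ne_zero
    have h2 := fun x => (w x).im_ne_zero
    fun_prop (disch := simpa)
  have h1 := hc 1 continuous_one
  have h2 := hc nsq hN
  have h3 := hc UpperHalfPlane.re UpperHalfPlane.continuous_re
  have h0 := fun x => (mixCoeff_one_pos (t x) (z x) (w x)).ne'
  have hD : Continuous fun x => mixDisc (t x) (z x) (w x) := by unfold mixDisc; fun_prop
  refine UpperHalfPlane.isOpenEmbedding_coe.isInducing.continuous_iff.2 ?_
  have e : (UpperHalfPlane.coe ∘ fun x => mix (t x) (z x) (w x)) = fun x =>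
      Complex.equivRealProdCLM.symm (mixCoeff UpperHalfPlane.re (t x) (z x) (w x) /
        mixCoeff 1 (t x) (z x) (w x), √(mixDisc (t x) (z x) (w x)) / mixCoeff 1 (t x) (z x) (w x)) := by
    funext x; apply Complex.ext <;> simp [mix]
  rw [e]
  refine (ContinuousLinearEquiv.continuous _).comp ((h3.div h1 h0).prodMk (hD.sqrt.div h1 h0))

/-- Mixing in a point strictly inside a half-plane makes the inequality strict, which pushes points
of the triangle into its interior. -/
lemma mix_pos {a b c : ℝ} {t : unitInterval} {z w : ℍ} (ht : 0 < t)
    (hz : 0 ≤ a * nsq z + b * z.re + c) (hw : 0 < a * nsq w + b * w.re + c) :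
    0 < a * nsq (mix t z w) + b * (mix t z w).re + c := by
  have h := mixCoeff_one_pos t z w
  have h1 := z.im_pos
  have h2 := w.im_pos
  have ht' : (0 : ℝ) < t := ht
  have ht1 : (0 : ℝ) ≤ 1 - t := sub_nonneg.2 t.2.2
  have key : a * nsq (mix t z w) + b * (mix t z w).re + c =
      ((1 - t) * ((a * nsq z + b * z.re + c) / z.im) +
        t * ((a * nsq w + b * w.re + c) / w.im)) / mixCoeff 1 t z w := by
    rw [nsq_mix, re_mix, eq_div_iff h.ne', add_mul, add_mul, mul_assoc, mul_assoc,
      div_mul_cancel₀ _ h.ne', div_mul_cancel₀ _ h.ne']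
    simp only [mixCoeff, Pi.one_apply]
    ring
  rw [key]
  exact div_pos (add_pos_of_nonneg_of_pos (mul_nonneg ht1 (div_nonneg hz h1.le))
    (mul_pos ht' (div_pos hw h2))) h

/-- The interior of the triangle. -/
def triangleInt : Set ℍ := {z | 0 < z.re ∧ z.re < 1 / 2 ∧ 2 * z.re < nsq z}

lemma isOpen_triangleInt : IsOpen triangleInt := by
  have := continuous_nsq
  simp only [triangleInt, Set.ofPred_and]
  refine (isOpen_lt ?_ ?_).inter ((isOpen_lt ?_ ?_).inter (isOpen_lt ?_ ?_)) <;> fun_prop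

lemma triangleInt_subset : triangleInt ⊆ triangle := fun _ hz =>
  mem_triangle.2 ⟨hz.1.le, hz.2.1.le, hz.2.2.le⟩

lemma nonempty_triangleInt : triangleInt.Nonempty := by
  refine ⟨⟨⟨1 / 4, 1⟩, one_pos⟩, ?_⟩
  simp only [triangleInt, Set.mem_ofPred_eq, nsq]
  change (0 : ℝ) < 1 / 4 ∧ (1 / 4 : ℝ) < 1 / 2 ∧ 2 * (1 / 4 : ℝ) < (1 / 4) ^ 2 + 1 ^ 2
  norm_num

lemma triangle_subset_closure : triangle ⊆ closure triangleInt := by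
  intro z hz
  obtain ⟨w, hw⟩ := nonempty_triangleInt
  rw [mem_triangle] at hz
  have h0 : (0 : unitInterval) ∈ closure (Set.Ioi 0) := by
    rw [closure_Ioi' ⟨1, zero_lt_one⟩]; exact Set.self_mem_Ici
  have := map_mem_closure (f := fun t => mix t z w)
    (continuous_mix continuous_id continuous_const continuous_const) h0 (t := triangleInt) ?_
  · rwa [mix_zero] at this
  · intro t ht
    obtain ⟨h1, h2, h3⟩ := hw
    have k1 := mix_pos (a := 0) (b := 1) (c := 0) (z := z) (w := w) ht (by linarith) (by linarith)
    have k2 := mix_pos (a := 0) (b := -1) (c := 1 / 2) (z := z) (w := w) ht (by linarith)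
      (by linarith)
    have k3 := mix_pos (a := 1) (b := -2) (c := 0) (z := z) (w := w) ht (by linarith) (by linarith)
    exact ⟨by linarith, by linarith, by linarith⟩


/-! ### Topology of geometric realisations -/

namespace Multigraph

variable {X Y : Multigraph}

/-- The point of the realisation with parameter `t` on the edge `e`. -/
def edgePt (e : X.Edge) (t : unitInterval) : X.Realization := Quot.mk _ (Sum.inr (e, t))

/-- The point of the realisation that corresponds to a vertex. -/
def vertPt (v : X.Vert) : X.Realization := Quot.mk _ (Sum.inl v)

lemma edgePt_zero (e : X.Edge) : edgePt e 0 = vertPt (X.ends e false) := Quot.sound (.zero e)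

lemma edgePt_one (e : X.Edge) : edgePt e 1 = vertPt (X.ends e true) := Quot.sound (.one e)

instance : DiscreteTopology X.Vert := ⟨rfl⟩

instance : DiscreteTopology X.Edge := ⟨rfl⟩

lemma continuous_edgePt (e : X.Edge) : Continuous (edgePt e) :=
  continuous_quot_mk.comp (continuous_inr.comp (Continuous.prodMk_right e))

lemma continuous_of_edgePt {Z : Type*} [TopologicalSpace Z] {f : X.Realization → Z}
    (h : ∀ e, Continuous fun t => f (edgePt e t)) : Continuous f := by
  refine isQuotientMap_quot_mk.continuous_iff.2 (continuous_sum_dom.2 ⟨?_, ?_⟩)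
  · exact continuous_of_discreteTopology
  · exact continuous_prod_of_discrete_left.2 h

lemma Hom.continuous_realize (φ : Hom X Y) : Continuous φ.realize :=
  continuous_of_edgePt fun e => continuous_edgePt (φ.edge e)

lemma realization_cases (hX : ∀ v, ∃ e b, X.ends e b = v) (x : X.Realization) :
    ∃ e t, x = edgePt e t := by
  induction x using Quot.ind with
  | mk x =>
    rcases x with v | ⟨e, t⟩
    · obtain ⟨e, b, rfl⟩ := hX v
      cases b
      exacts [⟨e, 0, (edgePt_zero e).symm⟩, ⟨e, 1, (edgePt_one e).symm⟩]
    · exact ⟨e, t, rfl⟩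

end Multigraph

open Multigraph

/-! ### The retraction onto the tree -/

/-- The point of the realisation of the tree with parameter `t` on the edge `g`. -/
def treePt (g : PSL(2, ℤ)) (t : unitInterval) : treeT.Realization := edgePt (X := treeT) g t

lemma treeMap_treePt (g : PSL(2, ℤ)) (t : unitInterval) :
    treeMap (treePt g t) = g • arc t := rfl

lemma re_arc (t : unitInterval) : (arc t).re = t / 2 := rfl

lemma nsq_arc (t : unitInterval) : nsq (arc t) = 1 := by
  have h0 := t.2.1
  have h1 := t.2.2
  change ((t : ℝ) / 2) ^ 2 + √(1 - ((t : ℝ) / 2) ^ 2) ^ 2 = 1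
  rw [Real.sq_sqrt (by nlinarith)]
  ring

lemma continuous_arc : Continuous arc := by
  refine UpperHalfPlane.isOpenEmbedding_coe.isInducing.continuous_iff.2 ?_
  have e : (UpperHalfPlane.coe ∘ arc) = fun t : unitInterval =>
      Complex.equivRealProdCLM.symm ((t : ℝ) / 2, √(1 - ((t : ℝ) / 2) ^ 2)) := by
    funext x; apply Complex.ext <;> simp [arc]
  rw [e]
  refine (ContinuousLinearEquiv.continuous _).comp ?_
  fun_prop

lemma arc_mem_triangle (t : unitInterval) : arc t ∈ triangle := by
  have h0 := t.2.1
  have h1 := t.2.2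
  rw [mem_triangle, re_arc, nsq_arc]
  exact ⟨by linarith, by linarith, by linarith⟩

lemma arc_injective : Function.Injective arc := fun s t h => by
  have := congrArg UpperHalfPlane.re h
  rw [re_arc, re_arc] at this
  exact Subtype.ext (by linarith)

/-- The function on the triangle whose level sets are the fibres of the retraction. -/
def level (z : ℍ) : unitInterval :=
  Set.projIcc 0 1 zero_le_one (max (2 * z.re) (2 * z.re / nsq z))

lemma continuous_level : Continuous level := by
  have h := continuous_nsq
  have h0 := fun z => (nsq_pos z).ne'
  refine continuous_projIcc.comp (Continuous.max (by fun_prop) ?_)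
  exact Continuous.div (by fun_prop) h h0

lemma coe_level {z : ℍ} (hz : z ∈ triangle) :
    (level z : ℝ) = max (2 * z.re) (2 * z.re / nsq z) := by
  rw [mem_triangle] at hz
  have h := nsq_pos z
  rw [level, Set.projIcc_of_mem zero_le_one]
  refine ⟨le_max_of_le_left (by linarith), max_le (by linarith) ?_⟩
  rw [div_le_one h]; exact hz.2.2

lemma level_arc (t : unitInterval) : level (arc t) = t := by
  refine Subtype.ext ?_
  rw [coe_level (arc_mem_triangle t), nsq_arc, re_arc, div_one, max_self]
  ring

lemma level_eq_zero {z : ℍ} (hz : z ∈ triangle) : level z = 0 ↔ z.re = 0 := by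
  have h := nsq_pos z
  rw [← Subtype.coe_inj, coe_level hz]
  change max _ _ = (0 : ℝ) ↔ _
  rw [mem_triangle] at hz
  constructor
  · intro h1
    have := le_max_left (2 * z.re) (2 * z.re / nsq z)
    linarith
  · intro h1; simp [h1]

lemma level_eq_one {z : ℍ} (hz : z ∈ triangle) : level z = 1 ↔ z ∈ cornerSides := by
  have h := nsq_pos z
  have h1 : (level z : ℝ) ≤ 1 := (level z).2.2
  rw [← Subtype.coe_inj, coe_level hz, mem_cornerSides, and_iff_right hz]
  rw [coe_level hz, max_le_iff] at h1
  change max _ _ = (1 : ℝ) ↔ _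
  constructor
  · intro h2
    rcases max_choice (2 * z.re) (2 * z.re / nsq z) with h3 | h3 <;> rw [h3] at h2
    · left; linarith
    · right; rw [div_eq_one_iff_eq h.ne'] at h2; exact h2.symm
  · rintro (h2 | h2)
    · rw [max_eq_left] <;> linarith
    · rw [max_eq_right, ← h2, div_self h.ne']
      rw [← h2, div_self h.ne']; linarith

lemma treePt_zero {g h : PSL(2, ℤ)} (hgh : g⁻¹ * h ∈ G₀) : treePt g 0 = treePt h 0 := by
  refine (edgePt_zero (X := treeT) g).trans (Eq.trans ?_ (edgePt_zero (X := treeT) h).symm)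
  exact congrArg (fun v => vertPt (X := treeT) (Sum.inl v)) (QuotientGroup.eq.2 hgh)

lemma treePt_one {g h : PSL(2, ℤ)} (hgh : g⁻¹ * h ∈ G₁) : treePt g 1 = treePt h 1 := by
  refine (edgePt_one (X := treeT) g).trans (Eq.trans ?_ (edgePt_one (X := treeT) h).symm)
  exact congrArg (fun v => vertPt (X := treeT) (Sum.inr v)) (QuotientGroup.eq.2 hgh)

/-- Triangles meet only along a common side. There both levels are 0 or both are 1, and the two
edges of 𝐓 share the corresponding vertex. Hence `toTree` does not depend on the chosen triangle. -/
lemma treePt_level_eq {g h : PSL(2, ℤ)} {z : ℍ} (hg : z ∈ g • triangle) (hh : z ∈ h • triangle) :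
    treePt g (level (g⁻¹ • z)) = treePt h (level (h⁻¹ • z)) := by
  rw [mem_smul_triangle] at hg hh
  obtain ⟨k, rfl⟩ : ∃ k, h = g * k := ⟨g⁻¹ * h, by simp⟩
  rw [mul_inv_rev, mul_smul] at hh ⊢
  generalize g⁻¹ • z = w at hg hh
  rcases triangle_inter hg hh with rfl | ⟨rfl, h0⟩ | ⟨hk, h1⟩
  · simp
  · have h0' : (gS⁻¹ • w).re = 0 := by rw [gS_inv, re_gS, h0]; simp
    rw [(level_eq_zero hg).2 h0, (level_eq_zero hh).2 h0']
    exact treePt_zero (mem_G₀.2 (by simp))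
  · have h1' : k⁻¹ • w ∈ cornerSides := by
      refine mem_cornerSides_of_mem_side hh ?_
      rcases hk with rfl | rfl
      · exact Reduced.U_inv.smul_mem_side hg
      · rw [inv_inv]; exact Reduced.U.smul_mem_side hg
    rw [(level_eq_one hg).2 h1, (level_eq_one hh).2 h1']
    exact treePt_one (mem_G₁.2 (by simpa using Or.inr hk))

/-- The equivariant map from the hyperbolic plane to the abstract tree. -/
def toTree (z : ℍ) : treeT.Realization :=
  treePt (exists_mem_smul_triangle z).choose
    (level ((exists_mem_smul_triangle z).choose⁻¹ • z))

lemma toTree_eq {g : PSL(2, ℤ)} {z : ℍ} (hg : z ∈ g • triangle) :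
    toTree z = treePt g (level (g⁻¹ • z)) :=
  treePt_level_eq (exists_mem_smul_triangle z).choose_spec hg

lemma isClosed_smul_triangle (g : PSL(2, ℤ)) : IsClosed (g • triangle) := isClosed_triangle.smul g

lemma continuous_toTree : Continuous toTree := by
  refine locallyFinite_triangle.continuous ?_ isClosed_smul_triangle fun g => ?_
  · exact Set.eq_univ_of_forall fun z => Set.mem_iUnion.2 (exists_mem_smul_triangle z)
  · refine ContinuousOn.congr (f := fun z => treePt g (level (g⁻¹ • z))) ?_
      fun z hz => toTree_eq hz
    exact ((continuous_edgePt (X := treeT) g).comp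
      (continuous_level.comp (continuous_const_smul g⁻¹))).continuousOn

lemma continuous_treeMap : Continuous treeMap := by
  refine continuous_of_edgePt (X := treeT) ?_
  change ∀ g : PSL(2, ℤ), Continuous fun t => g • arc t
  exact fun g => continuous_arc.const_smul g

lemma treeMap_toTree {g : PSL(2, ℤ)} {z : ℍ} (hg : z ∈ g • triangle) :
    treeMap (toTree z) = g • arc (level (g⁻¹ • z)) := by
  rw [toTree_eq hg, treeMap_treePt]

lemma treeMap_toTree_smul (g : PSL(2, ℤ)) (z : ℍ) :
    treeMap (toTree (g • z)) = g • treeMap (toTree z) := by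
  obtain ⟨h, hz⟩ := exists_mem_smul_triangle z
  have hgz : g • z ∈ (g * h) • triangle := by
    rw [mul_smul]; exact Set.smul_mem_smul_set hz
  rw [treeMap_toTree hz, treeMap_toTree hgz, mul_inv_rev, mul_smul, mul_smul, inv_smul_smul]

lemma isTreeRetraction_treeMap_toTree : IsTreeRetraction (treeMap ∘ toTree) where
  continuous := continuous_treeMap.comp continuous_toTree
  equivariant := treeMap_toTree_smul
  mem_hTree z := by
    obtain ⟨g, hg⟩ := exists_mem_smul_triangle z
    rw [Function.comp_apply, treeMap_toTree hg]
    exact Set.mem_iUnion.2 ⟨g, Set.smul_mem_smul_set ⟨_, rfl⟩⟩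
  fix_hTree z hz := by
    obtain ⟨g, _, ⟨t, rfl⟩, rfl⟩ := Set.mem_iUnion.1 hz
    have h : g • arc t ∈ g • triangle := Set.smul_mem_smul_set (arc_mem_triangle t)
    change treeMap (toTree (g • arc t)) = _
    rw [treeMap_toTree h, inv_smul_smul, level_arc]
  mapsTo z hz := by
    have h : z ∈ (1 : PSL(2, ℤ)) • triangle := by rwa [one_smul]
    rw [Function.comp_apply, treeMap_toTree h, one_smul]
    exact ⟨_, rfl⟩
  eq_I_iff z hz := by
    have h : z ∈ (1 : PSL(2, ℤ)) • triangle := by rwa [one_smul]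
    rw [Function.comp_apply, treeMap_toTree h, one_smul, inv_one, one_smul, ← arc_zero,
      arc_injective.eq_iff, level_eq_zero hz]
  eq_corner_iff z hz := by
    have h : z ∈ (1 : PSL(2, ℤ)) • triangle := by rwa [one_smul]
    rw [Function.comp_apply, treeMap_toTree h, one_smul, inv_one, one_smul, ← arc_one,
      arc_injective.eq_iff, level_eq_one hz]

/-! ### The homotopy equivalence -/

variable (G : Subgroup PSL(2, ℤ))

/-- The orbit of a point. -/
def orbitMk (z : ℍ) : MulAction.orbitRel.Quotient G ℍ := Quotient.mk _ z

variable {G}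

lemma orbitMk_eq {z w : ℍ} : orbitMk G z = orbitMk G w ↔ ∃ g ∈ G, g • w = z := by
  refine Quotient.eq.trans ?_
  rw [MulAction.orbitRel_apply, MulAction.mem_orbit_iff]
  simp [Subgroup.smul_def]

lemma orbitMk_smul {g : PSL(2, ℤ)} (hg : g ∈ G) (z : ℍ) : orbitMk G (g • z) = orbitMk G z :=
  orbitMk_eq.2 ⟨g, hg, rfl⟩

lemma G₀_smul {g : PSL(2, ℤ)} (hg : g ∈ G₀) : g • UpperHalfPlane.I = UpperHalfPlane.I := by
  rcases mem_G₀.1 hg with rfl | rfl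
  exacts [one_smul _ _, matS_smul]

lemma gU_smul_corner : gU • corner = corner := matU_smul

lemma G₁_smul {g : PSL(2, ℤ)} (hg : g ∈ G₁) : g • corner = corner := by
  rcases mem_G₁.1 hg with rfl | rfl | rfl
  exacts [one_smul _ _, gU_smul_corner, inv_smul_eq_iff.2 gU_smul_corner.symm]

variable (G)

/-- The edge of `XComb G` given by a coset. -/
def mkEdge (g : PSL(2, ℤ)) : (XComb G).Edge := Quotient.mk'' g

lemma mkEdge_surjective : Function.Surjective (mkEdge G) := Quotient.mk''_surjective

variable {G}

lemma mkEdge_eq {g h : PSL(2, ℤ)} : mkEdge G g = mkEdge G h ↔ h * g⁻¹ ∈ G :=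
  Quotient.eq''.trans QuotientGroup.rightRel_apply

lemma mkEdge_mul {g : PSL(2, ℤ)} (hg : g ∈ G) (h : PSL(2, ℤ)) : mkEdge G (g * h) = mkEdge G h :=
  mkEdge_eq.2 (by simpa using hg)

lemma exists_ends_eq (v : (XComb G).Vert) : ∃ e b, (XComb G).ends e b = v := by
  rcases v with v | v <;> induction v using Quotient.inductionOn' with | h g => ?_
  · exact ⟨mkEdge G g, false, rfl⟩
  · exact ⟨mkEdge G g, true, rfl⟩

variable (G)

/-- The map from the graph to the quotient surface. -/
def graphToOrbit : (XComb G).Realization → MulAction.orbitRel.Quotient G ℍ :=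
  Quot.lift
    (Sum.elim
      (Sum.elim (fun v => orbitMk G (v.out • UpperHalfPlane.I)) (fun v => orbitMk G (v.out • corner)))
      (fun x : Quotient (QuotientGroup.rightRel G) × unitInterval =>
        orbitMk G (x.1.out • arc x.2))) (by
    rintro _ _ (e | e)
    · obtain ⟨g, rfl⟩ := mkEdge_surjective G e
      obtain ⟨h, k, hh, hk, hhk⟩ := DoubleCoset.mk_out_eq_mul G G₀ g
      change orbitMk G ((mkEdge G g).out • arc 0) = orbitMk G ((DoubleCoset.mk G G₀ g).out • _)
      rw [hhk, mul_smul, mul_smul, G₀_smul hk, orbitMk_smul hh, arc_zero]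
      have h1 : g * (mkEdge G g).out⁻¹ ∈ G := mkEdge_eq.1 (Quotient.out_eq' (mkEdge G g))
      rw [← orbitMk_smul h1, mul_smul, inv_smul_smul]
    · obtain ⟨g, rfl⟩ := mkEdge_surjective G e
      obtain ⟨h, k, hh, hk, hhk⟩ := DoubleCoset.mk_out_eq_mul G G₁ g
      change orbitMk G ((mkEdge G g).out • arc 1) = orbitMk G ((DoubleCoset.mk G G₁ g).out • _)
      rw [hhk, mul_smul, mul_smul, G₁_smul hk, orbitMk_smul hh, arc_one]
      have h1 : g * (mkEdge G g).out⁻¹ ∈ G := mkEdge_eq.1 (Quotient.out_eq' (mkEdge G g))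
      rw [← orbitMk_smul h1, mul_smul, inv_smul_smul])

lemma graphToOrbit_edgePt (g : PSL(2, ℤ)) (t : unitInterval) :
    graphToOrbit G (edgePt (mkEdge G g) t) = orbitMk G (g • arc t) := by
  change orbitMk G ((mkEdge G g).out • arc t) = _
  have h1 : g * (mkEdge G g).out⁻¹ ∈ G := mkEdge_eq.1 (Quotient.out_eq' (mkEdge G g))
  rw [← orbitMk_smul h1, mul_smul, inv_smul_smul]

lemma continuous_orbitMk : Continuous (orbitMk G) := continuous_quot_mk

lemma continuous_graphToOrbit : Continuous (graphToOrbit G) := by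
  refine continuous_of_edgePt fun e => ?_
  obtain ⟨g, rfl⟩ := mkEdge_surjective G e
  simp only [graphToOrbit_edgePt]
  exact (continuous_orbitMk G).comp (continuous_arc.const_smul g)

/-- The map from the quotient surface to the graph. -/
def orbitToGraph : MulAction.orbitRel.Quotient G ℍ → (XComb G).Realization :=
  Quotient.lift (fun z => (treeProj G).realize (toTree z)) (by
    intro z w h
    obtain ⟨g, hg, rfl⟩ := orbitMk_eq.1 (Quotient.sound h : orbitMk G z = orbitMk G w)
    obtain ⟨h, hw⟩ := exists_mem_smul_triangle w
    have hgw : g • w ∈ (g * h) • triangle := by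
      rw [mul_smul]; exact Set.smul_mem_smul_set hw
    rw [toTree_eq hw, toTree_eq hgw, mul_inv_rev, mul_smul, inv_smul_smul]
    exact congrArg (fun e => edgePt e (level (h⁻¹ • w))) (mkEdge_mul hg h))

lemma orbitToGraph_orbitMk {g : PSL(2, ℤ)} {z : ℍ} (hg : z ∈ g • triangle) :
    orbitToGraph G (orbitMk G z) = edgePt (mkEdge G g) (level (g⁻¹ • z)) := by
  change (treeProj G).realize (toTree z) = _
  rw [toTree_eq hg]; rfl

lemma continuous_orbitToGraph : Continuous (orbitToGraph G) :=
  Continuous.quotient_lift ((treeProj G).continuous_realize.comp continuous_toTree) _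

lemma orbitToGraph_graphToOrbit (x : (XComb G).Realization) :
    orbitToGraph G (graphToOrbit G x) = x := by
  obtain ⟨e, t, rfl⟩ := realization_cases exists_ends_eq x
  obtain ⟨g, rfl⟩ := mkEdge_surjective G e
  rw [graphToOrbit_edgePt, orbitToGraph_orbitMk G
    (Set.smul_mem_smul_set (arc_mem_triangle t)), inv_smul_smul, level_arc]

lemma graphToOrbit_orbitToGraph (z : ℍ) :
    graphToOrbit G (orbitToGraph G (orbitMk G z)) = orbitMk G (treeMap (toTree z)) := by
  obtain ⟨g, hg⟩ := exists_mem_smul_triangle z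
  rw [orbitToGraph_orbitMk G hg, graphToOrbit_edgePt, treeMap_toTree hg]

instance : ContinuousConstSMul G ℍ := ⟨fun g => continuous_const_smul (g : PSL(2, ℤ))⟩

/-- The homotopy from the retraction to the identity, on the quotient surface. -/
def orbitHomotopy (x : unitInterval × MulAction.orbitRel.Quotient G ℍ) :
    MulAction.orbitRel.Quotient G ℍ :=
  Quotient.lift (fun z => orbitMk G (mix x.1 (treeMap (toTree z)) z)) (by
    intro z w h
    obtain ⟨g, hg, rfl⟩ := orbitMk_eq.1 (Quotient.sound h : orbitMk G z = orbitMk G w)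
    rw [treeMap_toTree_smul, mix_smul, orbitMk_smul hg]) x.2

lemma continuous_orbitHomotopy : Continuous (orbitHomotopy G) := by
  -- A product of a quotient map with the identity need not be a quotient map in general; here the
  -- orbit map is open, so it is.
  have hq : IsOpenQuotientMap (Prod.map id (orbitMk G) : unitInterval × ℍ → _) :=
    IsOpenQuotientMap.id.prodMap MulAction.isOpenQuotientMap_quotientMk
  rw [← hq.continuous_comp_iff]
  exact (continuous_orbitMk G).comp (continuous_mix continuous_fst
    (continuous_treeMap.comp (continuous_toTree.comp continuous_snd)) continuous_snd)

/-- One composite is the identity because `level (arc t) = t`; the other is induced by the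
retraction of ℍ, which `orbitHomotopy` joins to the identity. -/
theorem nonempty_homotopyEquiv :
    Nonempty ((XComb G).Realization ≃ₕ MulAction.orbitRel.Quotient G ℍ) := by
  refine ⟨⟨⟨graphToOrbit G, continuous_graphToOrbit G⟩, ⟨orbitToGraph G, continuous_orbitToGraph G⟩,
    ?_, ⟨⟨⟨orbitHomotopy G, continuous_orbitHomotopy G⟩, fun x => ?_, fun x => ?_⟩⟩⟩⟩
  · rw [show ContinuousMap.comp ⟨orbitToGraph G, continuous_orbitToGraph G⟩
      ⟨graphToOrbit G, continuous_graphToOrbit G⟩ = ContinuousMap.id _ from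
      ContinuousMap.ext (orbitToGraph_graphToOrbit G)]
  · induction x using Quotient.inductionOn' with
    | h z =>
      refine Eq.trans ?_ (graphToOrbit_orbitToGraph G z).symm
      change orbitMk G (mix 0 (treeMap (toTree z)) z) = _
      rw [mix_zero]
  · induction x using Quotient.inductionOn' with
    | h z =>
      change orbitMk G (mix 1 (treeMap (toTree z)) z) = orbitMk G z
      rw [mix_one]


/-! ### Trees -/

/-- A graph is a tree if its edges join each vertex other than the root with its parent, where
the parent function decreases some depth function. -/
theorem isTree_of_parent {V : Type*} {T : SimpleGraph V} (r : V) (d : V → ℕ) (par : V → V)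
    (hd : ∀ v, v ≠ r → d (par v) < d v)
    (hadj : ∀ u v, T.Adj u v ↔ u ≠ r ∧ par u = v ∨ v ≠ r ∧ par v = u) : T.IsTree := by
  classical
  have hreach : ∀ n v, d v = n → T.Reachable v r := by
    intro n
    induction n using Nat.strong_induction_on with
    | _ n ih =>
      rintro v rfl
      by_cases hv : v = r
      · rw [hv]
      · exact (SimpleGraph.Adj.reachable ((hadj v (par v)).2 (Or.inl ⟨hv, rfl⟩))).trans
          (ih _ (hd v hv) _ rfl)
  have : Nonempty V := ⟨r⟩
  refine ⟨SimpleGraph.Connected.mk fun u v => (hreach _ u rfl).trans (hreach _ v rfl).symm, ?_⟩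
  intro v c hc
  -- Every neighbour on the cycle of a deepest vertex m must be the parent of m, whereas the two
  -- neighbours of m on a cycle are distinct.
  obtain ⟨m, hm, hmax⟩ := c.support.toFinset.exists_max_image d ⟨v, by simp⟩
  rw [List.mem_toFinset] at hm
  have hc' : (c.rotate m hm).IsCycle := (SimpleGraph.Walk.isCycle_rotate hm).2 hc
  have key : ∀ x ∈ (c.rotate m hm).support, T.Adj m x → x = par m := by
    intro x hx hmx
    rw [SimpleGraph.Walk.mem_support_rotate_iff] at hx
    rcases (hadj m x).1 hmx with ⟨-, h⟩ | ⟨hxr, h⟩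
    · exact h.symm
    · have h1 := hd x hxr
      rw [h] at h1
      exact absurd (hmax x (List.mem_toFinset.2 hx)) (not_le.2 h1)
  refine hc'.snd_ne_penultimate ?_
  exact (key _ (SimpleGraph.Walk.getVert_mem_support _ _)
    (SimpleGraph.Walk.adj_snd hc'.not_nil)).trans
      (key _ (SimpleGraph.Walk.getVert_mem_support _ _)
        (SimpleGraph.Walk.adj_penultimate hc'.not_nil).symm).symm

/-- Transport of a value in a family of types along a walk. -/
def liftAlong {V : Type*} {T : SimpleGraph V} {F : V → Type*} (f : ∀ u v, T.Adj u v → F v → F u) :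
    ∀ {u r : V}, T.Walk u r → F r → F u
  | _, _, .nil, x => x
  | _, _, .cons h p, x => f _ _ h (liftAlong f p x)

/-- A relation between the fibres of a family over a tree that can be solved along each edge has a
section. -/
theorem exists_section {V : Type*} {T : SimpleGraph V} (hT : T.IsTree) {F : V → Type*}
    (R : ∀ u v, F u → F v → Prop) (hR : ∀ u v x y, R u v x y → R v u y x) (r : V) (x₀ : F r)
    (lift : ∀ u v, T.Adj u v → ∀ x : F v, ∃ y : F u, R u v y x) :
    ∃ s : ∀ v, F v, ∀ u v, T.Adj u v → R u v (s u) (s v) := by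
  choose f hf using lift
  choose path hpath _ using fun v => hT.existsUnique_path v r
  -- The value at each vertex is transported from r along the unique path. For adjacent vertices one
  -- of the two paths extends the other by the edge between them, and the relation holds by the
  -- choice of `f`.
  have key : ∀ u v, T.Adj u v → u ∉ (path v).support →
      R u v (liftAlong f (path u) x₀) (liftAlong f (path v) x₀) := by
    intro u v h hu
    have e : path u = .cons h (path v) := (hT.existsUnique_path u r).unique (hpath u)
      ((hpath v).cons hu)
    rw [e]
    exact hf u v h _
  refine ⟨fun v => liftAlong f (path v) x₀, fun u v h => ?_⟩
  by_cases hu : u ∈ (path v).support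
  · refine hR _ _ _ _ (key v u h.symm ?_)
    have := hT.isAcyclic.ne_mem_support_of_support_of_adj_of_isPath (hpath v).reverse
      (hpath u).reverse h.symm (by simpa using hu)
    simpa using this
  · exact key u v h hu

/-! ### Adjacency in multigraphs and the ends of edges in a cut graph -/

namespace Multigraph

variable {X : Multigraph}

lemma toSimpleGraph_adj {u v : X.Vert} :
    X.toSimpleGraph.Adj u v ↔ u ≠ v ∧ ∃ e b, X.ends e b = u ∧ X.ends e (!b) = v := by
  rw [toSimpleGraph, SimpleGraph.fromRel_adj]
  refine and_congr_right fun _ => ?_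
  constructor
  · rintro (⟨e, h1, h2⟩ | ⟨e, h1, h2⟩)
    exacts [⟨e, false, h1, h2⟩, ⟨e, true, h2, h1⟩]
  · rintro ⟨e, b, h1, h2⟩
    cases b
    exacts [Or.inl ⟨e, h1, h2⟩, Or.inr ⟨e, h2, h1⟩]

lemma reachable_ends (e : X.Edge) (b b' : Bool) :
    X.toSimpleGraph.Reachable (X.ends e b) (X.ends e b') := by
  by_cases h : X.ends e b = X.ends e b'
  · rw [h]
  · refine SimpleGraph.Adj.reachable (toSimpleGraph_adj.2 ⟨h, e, b, rfl, ?_⟩)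
    cases b <;> cases b' <;> simp_all

variable {C : Set X.Vert}

/-- A vertex that is not cut, as a vertex of the cut graph. -/
def uncut (v : X.Vert) (h : v ∉ C) : (X.cut C).Vert := Sum.inl ⟨v, h⟩

/-- A univalent vertex that arises from a cut. -/
def leaf (e : X.Edge) (b : Bool) (h : X.ends e b ∈ C) : (X.cut C).Vert := Sum.inr ⟨(e, b), h⟩

lemma leaf_injective {e e' : X.Edge} {b b' : Bool} {h : X.ends e b ∈ C} {h' : X.ends e' b' ∈ C}
    (H : leaf e b h = leaf e' b' h') : e = e' :=
  congrArg (fun x : {h : X.Edge × Bool // X.ends h.1 h.2 ∈ C} => x.1.1) (Sum.inr.inj H)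

lemma uncut_injective {v w : X.Vert} {h : v ∉ C} {h' : w ∉ C} (H : uncut v h = uncut w h') :
    v = w :=
  congrArg Subtype.val (Sum.inl.inj H)

lemma leaf_ne_uncut {e : X.Edge} {b : Bool} {h : X.ends e b ∈ C} {v : X.Vert} {h' : v ∉ C} :
    leaf e b h ≠ uncut v h' := fun H => by cases H

variable (C) in
/-- The ends of the edges in the cut graph. -/
def cutEnds (e : X.Edge) (b : Bool) : (X.cut C).Vert := (X.cut C).ends e b

lemma cutEnds_of_mem {e : X.Edge} {b : Bool} (h : X.ends e b ∈ C) :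
    cutEnds C e b = leaf e b h := by
  simp [cutEnds, cut, h, leaf]

lemma cutEnds_of_notMem {e : X.Edge} {b : Bool} (h : X.ends e b ∉ C) :
    cutEnds C e b = uncut (X.ends e b) h := by
  simp [cutEnds, cut, h, uncut]

lemma cutEnds_eq_uncut {e : X.Edge} {b : Bool} {v : X.Vert} {hv : v ∉ C} :
    cutEnds C e b = uncut v hv ↔ X.ends e b = v := by
  by_cases h : X.ends e b ∈ C
  · rw [cutEnds_of_mem h]
    exact ⟨fun H => absurd H leaf_ne_uncut, fun H => absurd (H ▸ h) hv⟩
  · rw [cutEnds_of_notMem h]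
    exact ⟨uncut_injective, fun H => by subst H; rfl⟩

lemma valency_uncut {v : X.Vert} (hv : v ∉ C) : (X.cut C).valency (uncut v hv) = X.valency v :=
  Nat.card_congr (Equiv.subtypeEquivRight fun _ => cutEnds_eq_uncut)

lemma cutProj_cutEnds (e : X.Edge) (b : Bool) :
    (X.cutProj C).vert (cutEnds C e b) = X.ends e b := (X.cutProj C).comm e b

end Multigraph

open Multigraph

/-! ### Incidence in the graphs -/

variable {G : Subgroup PSL(2, ℤ)}

lemma isRight_ends (e : (XComb G).Edge) (b : Bool) : ((XComb G).ends e b).isRight = b := by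
  obtain ⟨g, rfl⟩ := mkEdge_surjective G e
  cases b <;> rfl

lemma ends_ne (e e' : (XComb G).Edge) : (XComb G).ends e false ≠ (XComb G).ends e' true := fun h => by
  have := congrArg Sum.isRight h
  simp [isRight_ends] at this

lemma ends_false_eq {g h : PSL(2, ℤ)} :
    (XComb G).ends (mkEdge G h) false = (XComb G).ends (mkEdge G g) false ↔
      mkEdge G h = mkEdge G g ∨ mkEdge G h = mkEdge G (g * gS) := by
  change Sum.inl (DoubleCoset.mk G G₀ h) = Sum.inl (DoubleCoset.mk G G₀ g) ↔ _
  rw [Sum.inl.injEq, eq_comm, DoubleCoset.eq]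
  constructor
  · rintro ⟨a, ha, k, hk, rfl⟩
    rw [mul_assoc, mkEdge_mul ha]
    rcases mem_G₀.1 hk with rfl | rfl <;> simp
  · rintro (h1 | h1) <;> rw [eq_comm, mkEdge_eq] at h1
    · exact ⟨_, h1, 1, one_mem _, by simp⟩
    · exact ⟨_, h1, gS, mem_G₀.2 (by simp), by simp [mul_assoc]⟩

lemma ends_true_eq {g h : PSL(2, ℤ)} :
    (XComb G).ends (mkEdge G h) true = (XComb G).ends (mkEdge G g) true ↔
      mkEdge G h = mkEdge G g ∨ mkEdge G h = mkEdge G (g * gU) ∨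
        mkEdge G h = mkEdge G (g * gU⁻¹) := by
  change Sum.inr (DoubleCoset.mk G G₁ h) = Sum.inr (DoubleCoset.mk G G₁ g) ↔ _
  rw [Sum.inr.injEq, eq_comm, DoubleCoset.eq]
  constructor
  · rintro ⟨a, ha, k, hk, rfl⟩
    rw [mul_assoc, mkEdge_mul ha]
    rcases mem_G₁.1 hk with rfl | rfl | rfl <;> simp
  · rintro (h1 | h1 | h1) <;> rw [eq_comm, mkEdge_eq] at h1
    · exact ⟨_, h1, 1, one_mem _, by simp⟩
    · exact ⟨_, h1, gU, mem_G₁.2 (by simp), by simp [mul_assoc]⟩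
    · exact ⟨_, h1, gU⁻¹, mem_G₁.2 (by simp), by simp [mul_assoc]⟩

lemma valency_ends (e : (XComb G).Edge) (b : Bool) :
    (XComb G).valency ((XComb G).ends e b) =
      {e' | (XComb G).ends e' b = (XComb G).ends e b}.ncard := by
  refine Nat.card_congr
    ⟨fun x => ⟨x.1.1, ?_⟩, fun x => ⟨(x.1, b), x.2⟩, fun x => ?_, fun x => rfl⟩
  · obtain ⟨⟨e', b'⟩, h⟩ := x
    have := congrArg Sum.isRight h
    rw [isRight_ends, isRight_ends] at this
    subst this
    exact h
  · obtain ⟨⟨e', b'⟩, h⟩ := x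
    have := congrArg Sum.isRight h
    rw [isRight_ends, isRight_ends] at this
    subst this
    rfl

lemma valency_ends_false (g : PSL(2, ℤ)) :
    (XComb G).valency ((XComb G).ends (mkEdge G g) false) =
      ({mkEdge G g, mkEdge G (g * gS)} : Set (XComb G).Edge).ncard := by
  rw [valency_ends]
  congr 1
  ext e
  obtain ⟨h, rfl⟩ := mkEdge_surjective G e
  exact ends_false_eq

lemma valency_ends_true (g : PSL(2, ℤ)) :
    (XComb G).valency ((XComb G).ends (mkEdge G g) true) =
      ({mkEdge G g, mkEdge G (g * gU), mkEdge G (g * gU⁻¹)} : Set (XComb G).Edge).ncard := by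
  rw [valency_ends]
  congr 1
  ext e
  obtain ⟨h, rfl⟩ := mkEdge_surjective G e
  exact ends_true_eq

/-- All coincidences among the cosets of g, gU, gU⁻¹ amount to gUg⁻¹ ∈ G: an orbit of a group of
order 3 has one or three elements. -/
lemma mkEdge_gU_inv_eq_iff (g : PSL(2, ℤ)) :
    mkEdge G g = mkEdge G (g * gU⁻¹) ↔ mkEdge G g = mkEdge G (g * gU) := by
  rw [eq_comm, mkEdge_eq, mkEdge_eq]
  simp [mul_assoc]

lemma mkEdge_gU_inv_eq_gU_iff (g : PSL(2, ℤ)) :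
    mkEdge G (g * gU) = mkEdge G (g * gU⁻¹) ↔ mkEdge G g = mkEdge G (g * gU) := by
  rw [eq_comm (a := mkEdge G (g * gU)), mkEdge_eq, mkEdge_eq, mul_inv_rev, inv_inv, mul_assoc g gU,
    ← mul_assoc gU, gU_mul_self, ← inv_mem_iff]
  simp [mul_assoc]

lemma valency_ends_true_of_eq {g : PSL(2, ℤ)} (h : mkEdge G g = mkEdge G (g * gU)) :
    (XComb G).valency ((XComb G).ends (mkEdge G g) true) = 1 := by
  rw [valency_ends_true, ← (mkEdge_gU_inv_eq_iff g).2 h, ← h]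
  simp

lemma valency_ends_true_of_ne {g : PSL(2, ℤ)} (h : mkEdge G g ≠ mkEdge G (g * gU)) :
    (XComb G).valency ((XComb G).ends (mkEdge G g) true) = 3 := by
  rw [valency_ends_true]
  refine Set.ncard_eq_three.2 ⟨_, _, _, h, ?_, ?_, rfl⟩
  · rwa [Ne, mkEdge_gU_inv_eq_iff]
  · rwa [Ne, mkEdge_gU_inv_eq_gU_iff]

lemma valency_ends_true_ne_two (e : (XComb G).Edge) :
    (XComb G).valency ((XComb G).ends e true) ≠ 2 := by
  obtain ⟨g, rfl⟩ := mkEdge_surjective G e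
  by_cases h : mkEdge G g = mkEdge G (g * gU)
  · rw [valency_ends_true_of_eq h]; decide
  · rw [valency_ends_true_of_ne h]; decide

lemma connected_toSimpleGraph : (XComb G).toSimpleGraph.Connected := by
  have key : ∀ g : PSL(2, ℤ), (XComb G).toSimpleGraph.Reachable
      ((XComb G).ends (mkEdge G g) true) ((XComb G).ends (mkEdge G 1) true) := by
    refine psl_induction_right ?_ (fun g hg => ?_) (fun g hg => ?_)
    · rfl
    · refine (reachable_ends _ true false).trans ?_
      rw [ends_false_eq.2 (Or.inr rfl)]
      exact (reachable_ends _ false true).trans hg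
    · rwa [ends_true_eq.2 (Or.inr (Or.inl rfl))]
  have key' : ∀ v, (XComb G).toSimpleGraph.Reachable v ((XComb G).ends (mkEdge G 1) true) := by
    intro v
    obtain ⟨e, b, rfl⟩ := exists_ends_eq v
    obtain ⟨g, rfl⟩ := mkEdge_surjective G e
    exact (reachable_ends _ b true).trans (key g)
  have : Nonempty (XComb G).Vert := ⟨(XComb G).ends (mkEdge G 1) true⟩
  exact SimpleGraph.Connected.mk fun u v => (key' u).trans (key' v).symm

/-! ### Existence of cuts -/

/-- The first edge of a shortest walk to r; it serves as the parent edge of v in a breadth-first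
spanning tree. -/
lemma exists_edge_dist_lt {r v : (XComb G).Vert} (hv : v ≠ r) :
    ∃ e, (XComb G).ends e v.isRight = v ∧
      (XComb G).toSimpleGraph.dist ((XComb G).ends e !v.isRight) r <
        (XComb G).toSimpleGraph.dist v r := by
  obtain ⟨p, hp⟩ := connected_toSimpleGraph.exists_walk_length_eq_dist v r
  cases p with
  | nil => exact absurd rfl hv
  | @cons _ w _ h q =>
    obtain ⟨-, e, b, h1, h2⟩ := toSimpleGraph_adj.1 h
    have hb : v.isRight = b := by rw [← h1, isRight_ends]
    refine ⟨e, by rw [hb, h1], ?_⟩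
    rw [hb, h2, ← hp, SimpleGraph.Walk.length_cons]
    exact Nat.lt_succ_of_le (SimpleGraph.dist_le q)

instance : Nonempty (XComb G).Edge := ⟨mkEdge G 1⟩

lemma eq_or_eq_of_ends_false {e₀ e₁ e : (XComb G).Edge} (hne : e₀ ≠ e₁)
    (h1 : (XComb G).ends e₁ false = (XComb G).ends e₀ false)
    (h : (XComb G).ends e false = (XComb G).ends e₀ false) : e = e₀ ∨ e = e₁ := by
  obtain ⟨g, rfl⟩ := mkEdge_surjective G e₀
  obtain ⟨k, rfl⟩ := mkEdge_surjective G e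
  obtain ⟨k₁, rfl⟩ := mkEdge_surjective G e₁
  rcases ends_false_eq.1 h with h2 | h2
  · exact Or.inl h2
  · rcases ends_false_eq.1 h1 with h3 | h3
    · exact absurd h3.symm hne
    · exact Or.inr (h2.trans h3.symm)

lemma eq_of_valency_ne_two {e₀ e : (XComb G).Edge}
    (hv : (XComb G).valency ((XComb G).ends e₀ false) ≠ 2)
    (h : (XComb G).ends e false = (XComb G).ends e₀ false) : e = e₀ := by
  obtain ⟨g, rfl⟩ := mkEdge_surjective G e₀
  obtain ⟨k, rfl⟩ := mkEdge_surjective G e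
  have hg : mkEdge G g = mkEdge G (g * gS) := by
    by_contra hne
    rw [valency_ends_false, Set.ncard_pair hne] at hv
    exact hv rfl
  rcases ends_false_eq.1 h with h | h
  exacts [h, h.trans hg.symm]

variable (G)

/-- Take a breadth-first spanning tree rooted at a vertex of type 1. An edge outside it would close
a cycle; cutting its end of type 0 turns it into a hanging edge instead. -/
theorem exists_cut_isTree : ∃ C : Set (XComb G).Vert,
    (∀ v ∈ C, (XComb G).valency v = 2) ∧ ((XComb G).cut C).IsTree := by
  classical
  set r : (XComb G).Vert := (XComb G).ends (mkEdge G 1) true with hr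
  set D : (XComb G).Vert → ℕ := fun v => (XComb G).toSimpleGraph.dist v r with hD
  obtain ⟨pe, hpe⟩ : ∃ pe : (XComb G).Vert → (XComb G).Edge, ∀ v, v ≠ r →
      (XComb G).ends (pe v) v.isRight = v ∧ D ((XComb G).ends (pe v) !v.isRight) < D v := by
    choose! pe hpe using fun v (hv : v ≠ r) => exists_edge_dist_lt hv
    exact ⟨pe, hpe⟩
  have hrR : r.isRight = true := isRight_ends _ _
  have hleft : ∀ {v : (XComb G).Vert}, v.isRight = false → v ≠ r := by
    rintro v hv rfl; simp [hrR] at hv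
  -- The vertices of type 0 and valency 2 that are nobody's parent, that is, the ends of type 0 of
  -- the edges not used by the spanning tree, together with some harmless leaves if a parent edge is
  -- the only tree edge there.
  set C : Set (XComb G).Vert := {v | v.isRight = false ∧ (XComb G).valency v = 2 ∧
    ∀ w, w ≠ r → w.isRight = true → (XComb G).ends (pe w) false ≠ v} with hC
  have hCtrue : ∀ e, (XComb G).ends e true ∉ C := fun e h => by
    have := h.1; rw [isRight_ends] at this; cases this
  have hpeC : ∀ v, v ≠ r → (XComb G).ends (pe v) (!v.isRight) ∉ C := by
    intro v hv
    rcases hb : v.isRight with _ | _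
    · exact hCtrue _
    · exact fun h => h.2.2 v hv hb rfl
  -- the edges at a vertex of type 0 that is not cut
  have hedge : ∀ e, (XComb G).ends e false ∉ C → e = pe ((XComb G).ends e false) ∨
      (XComb G).ends e true ≠ r ∧ e = pe ((XComb G).ends e true) := by
    intro e he
    set v := (XComb G).ends e false with hv
    have hvR : v.isRight = false := isRight_ends _ _
    have hvr := hleft hvR
    obtain ⟨h1, h2⟩ := hpe v hvr
    rw [hvR] at h1 h2
    by_cases hval : (XComb G).valency v = 2
    · obtain ⟨w, hw, hwR, hwv⟩ : ∃ w, w ≠ r ∧ w.isRight = true ∧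
          (XComb G).ends (pe w) false = v := by
        by_contra! hcon
        exact he ⟨hvR, hval, hcon⟩
      obtain ⟨h3, h4⟩ := hpe w hw
      rw [hwR] at h3 h4
      simp only [Bool.not_true, Bool.not_false] at h2 h4
      have hne : pe v ≠ pe w := by
        intro h
        rw [hwv] at h4
        rw [h, h3] at h2
        exact lt_asymm h2 h4
      rcases eq_or_eq_of_ends_false hne (hwv.trans h1.symm) (hv.symm.trans h1.symm) with h | h
      · exact Or.inl h
      · right
        rw [h, h3]
        exact ⟨hw, rfl⟩
    · rw [← h1] at hval
      exact Or.inl (eq_of_valency_ne_two hval (hv.symm.trans h1.symm))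
  have hends : ∀ e e', cutEnds C e false ≠ cutEnds C e' true := fun e e' h => by
    have := congrArg ((XComb G).cutProj C).vert h
    rw [cutProj_cutEnds, cutProj_cutEnds] at this
    exact ends_ne _ _ this
  let r' : ((XComb G).cut C).Vert := uncut r (hCtrue _)
  -- A new univalent vertex hangs from the other end of its edge, hence the depth one more than
  -- there.
  let d : ((XComb G).cut C).Vert → ℕ :=
    Sum.elim (fun v => D v.1) (fun h => D ((XComb G).ends h.1.1 (!h.1.2)) + 1)
  let par : ((XComb G).cut C).Vert → ((XComb G).cut C).Vert :=
    Sum.elim (fun v => cutEnds C (pe v.1) (!v.1.isRight)) (fun h => cutEnds C h.1.1 (!h.1.2))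
  have hdu : ∀ v hv, d (uncut v hv) = D v := fun _ _ => rfl
  have hdl : ∀ e b h, d (leaf e b h) = D ((XComb G).ends e (!b)) + 1 := fun _ _ _ => rfl
  have hpu : ∀ v hv, par (uncut v hv) = cutEnds C (pe v) (!v.isRight) := fun _ _ => rfl
  have hpl : ∀ e b h, par (leaf e b h) = cutEnds C e (!b) := fun _ _ _ => rfl
  have hcases : ∀ x : ((XComb G).cut C).Vert, x ≠ r' →
      (∃ v hv, v ≠ r ∧ x = uncut v hv) ∨ ∃ e h, x = leaf e false h := by
    rintro (⟨v, hv⟩ | ⟨⟨e, b⟩, h⟩) hx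
    · refine Or.inl ⟨v, hv, ?_, rfl⟩
      rintro rfl
      exact hx rfl
    · cases b
      exacts [Or.inr ⟨e, h, rfl⟩, absurd h (hCtrue e)]
  have hdpar : ∀ v, v ≠ r' → d (par v) < d v := by
    intro x hx
    rcases hcases x hx with ⟨v, hv, hv', rfl⟩ | ⟨e, h, rfl⟩
    · rw [hpu, cutEnds_of_notMem (hpeC v hv'), hdu, hdu]
      exact (hpe v hv').2
    · rw [hpl, hdl, Bool.not_false, cutEnds_of_notMem (hCtrue _), hdu]
      exact Nat.lt_succ_self _
  have hparedge : ∀ v, v ≠ r' → ∃ e b, cutEnds C e b = v ∧ cutEnds C e (!b) = par v := by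
    intro x hx
    rcases hcases x hx with ⟨v, hv, hv', rfl⟩ | ⟨e, h, rfl⟩
    · exact ⟨pe v, v.isRight, cutEnds_eq_uncut.2 (hpe v hv').1, rfl⟩
    · exact ⟨e, false, cutEnds_of_mem h, rfl⟩
  have hedgepar : ∀ e, cutEnds C e false ≠ r' ∧ par (cutEnds C e false) = cutEnds C e true ∨
      cutEnds C e true ≠ r' ∧ par (cutEnds C e true) = cutEnds C e false := by
    intro e
    have hfr : cutEnds C e false ≠ r' := fun h => ends_ne _ _ (cutEnds_eq_uncut.1 h)
    by_cases he : (XComb G).ends e false ∈ C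
    · refine Or.inl ⟨hfr, ?_⟩
      rw [cutEnds_of_mem he, hpl, Bool.not_false]
    · rcases hedge e he with h | ⟨h0, h⟩
      · refine Or.inl ⟨hfr, ?_⟩
        rw [cutEnds_of_notMem he, hpu, ← h, isRight_ends, Bool.not_false]
      · refine Or.inr ⟨fun h1 => h0 (cutEnds_eq_uncut.1 h1), ?_⟩
        rw [cutEnds_of_notMem (hCtrue e), hpu, ← h, isRight_ends, Bool.not_true]
  refine ⟨C, fun v hv => hv.2.1, fun e => hends e e, ?_, ?_⟩
  · have inj : ∀ e e' : (XComb G).Edge, cutEnds C e false = cutEnds C e' false →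
        cutEnds C e true = cutEnds C e' true → e = e' := by
      intro e e' h1 h2
      by_cases he : (XComb G).ends e false ∈ C
      · by_cases he' : (XComb G).ends e' false ∈ C
        · rw [cutEnds_of_mem he, cutEnds_of_mem he'] at h1
          exact leaf_injective h1
        · rw [cutEnds_of_mem he, cutEnds_of_notMem he'] at h1
          exact absurd h1 leaf_ne_uncut
      · rw [cutEnds_of_notMem he, eq_comm, cutEnds_eq_uncut] at h1
        rw [cutEnds_of_notMem (hCtrue e), eq_comm, cutEnds_eq_uncut] at h2
        -- Parallel edges cannot be parent edges in opposite directions, since the depth drops along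
        -- each.
        have hlt : ∀ a b, a = pe ((XComb G).ends a false) → (XComb G).ends b true ≠ r →
            b = pe ((XComb G).ends b true) → (XComb G).ends a false = (XComb G).ends b false →
            (XComb G).ends a true ≠ (XComb G).ends b true := by
          intro a b ha hb0 hb hf ht
          have h3 := (hpe _ (hleft (isRight_ends a false))).2
          have h4 := (hpe _ hb0).2
          rw [← ha, isRight_ends] at h3
          rw [← hb, isRight_ends] at h4
          simp only [Bool.not_true, Bool.not_false] at h3 h4
          rw [ht, hf] at h3
          exact lt_asymm h3 h4
        rcases hedge e he with h | ⟨h0, h⟩ <;> rcases hedge e' (h1 ▸ he) with h' | ⟨h0', h'⟩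
        · rw [h, h', h1]
        · exact absurd h2.symm (hlt e e' h h0' h' h1.symm)
        · exact absurd h2 (hlt e' e h' h0 h h1)
        · rw [h, h', h2]
    intro e e' hee
    obtain ⟨h1, h2⟩ := (Sym2.eq_iff.1 hee).resolve_right fun h => hends _ _ h.1
    exact inj e e' h1 h2
  · refine isTree_of_parent r' d par hdpar fun u v => ?_
    rw [toSimpleGraph_adj]
    constructor
    · rintro ⟨-, e, b, rfl, rfl⟩
      have := hedgepar e
      cases b
      exacts [this, this.symm]
    · have key : ∀ u v, u ≠ r' → par u = v →
          u ≠ v ∧ ∃ e b, cutEnds C e b = u ∧ cutEnds C e (!b) = v := by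
        rintro u v hu rfl
        exact ⟨fun h => (hdpar u hu).ne (congrArg d h.symm), hparedge u hu⟩
      rintro (⟨hu, h⟩ | ⟨hv, h⟩)
      · exact key u v hu h
      · obtain ⟨h1, e, b, h2, h3⟩ := key v u hv h
        exact ⟨h1.symm, e, !b, h3, by rw [Bool.not_not]; exact h2⟩

/-! ### Existence of lifts -/

variable {G}

/-- Edges lift along 𝐓 → G\𝐓 from any lift of an end, because moving the representative by an
element of G₀ or G₁ reaches every edge at the vertex. -/
lemma exists_lift_edge {x : treeT.Vert} {e : (XComb G).Edge} {b : Bool}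
    (h : (treeProj G).vert x = (XComb G).ends e b) :
    ∃ g : PSL(2, ℤ), mkEdge G g = e ∧ treeT.ends g b = x := by
  obtain ⟨k, rfl⟩ := mkEdge_surjective G e
  rcases x with x | x <;> induction x using QuotientGroup.induction_on with | H g => ?_
  · cases b with
    | true => cases h
    | false =>
      obtain ⟨a, ha, c, hc, rfl⟩ := (DoubleCoset.eq G G₀ g k).1 (Sum.inl.inj h)
      refine ⟨g * c, ?_, ?_⟩
      · rw [mul_assoc a, mkEdge_mul ha]
      · exact congrArg Sum.inl (QuotientGroup.eq.2 (by simpa using inv_mem hc))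
  · cases b with
    | false => cases h
    | true =>
      obtain ⟨a, ha, c, hc, rfl⟩ := (DoubleCoset.eq G G₁ g k).1 (Sum.inr.inj h)
      refine ⟨g * c, ?_, ?_⟩
      · rw [mul_assoc a, mkEdge_mul ha]
      · exact congrArg Sum.inr (QuotientGroup.eq.2 (by simpa using inv_mem hc))

lemma exists_lift_vert (v : (XComb G).Vert) : ∃ x, (treeProj G).vert x = v := by
  obtain ⟨e, b, rfl⟩ := exists_ends_eq v
  obtain ⟨g, rfl⟩ := mkEdge_surjective G e
  exact ⟨treeT.ends g b, (treeProj G).comm g b⟩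

theorem exists_lift {C : Set (XComb G).Vert} (hC : ((XComb G).cut C).IsTree) :
    ∃ j : Multigraph.Hom ((XComb G).cut C) treeT,
      (treeProj G).comp j = (XComb G).cutProj C := by
  set X := (XComb G).cut C with hX
  let π := (XComb G).cutProj C
  let F : X.Vert → Type := fun v => {x : treeT.Vert // (treeProj G).vert x = π.vert v}
  let R : ∀ u v, F u → F v → Prop := fun u v x y => ∀ e b, X.ends e b = u → X.ends e (!b) = v →
    ∃ g : PSL(2, ℤ), mkEdge G g = e ∧ treeT.ends g b = x.1 ∧ treeT.ends g (!b) = y.1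
  obtain ⟨r⟩ := hC.simple_isTree.connected.nonempty
  obtain ⟨x₀, hx₀⟩ := exists_lift_vert (π.vert r)
  have hR : ∀ u v x y, R u v x y → R v u y x := by
    intro u v x y h e b h1 h2
    obtain ⟨g, h3, h4, h5⟩ := h e (!b) h2 (by rwa [Bool.not_not])
    exact ⟨g, h3, by rwa [Bool.not_not] at h5, h4⟩
  have hlift : ∀ u v, X.toSimpleGraph.Adj u v → ∀ x : F v, ∃ y : F u, R u v y x := by
    intro u v huv x
    obtain ⟨hne, e, b, rfl, rfl⟩ := toSimpleGraph_adj.1 huv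
    obtain ⟨g, hg, hgx⟩ := exists_lift_edge (x.2.trans (π.comm e (!b)))
    refine ⟨⟨treeT.ends g b, ?_⟩, ?_⟩
    · exact ((treeProj G).comm g b).trans
        ((congrArg (fun e => (XComb G).ends e b) hg).trans (π.comm e b).symm)
    · intro e' b' h1 h2
      -- A tree has no parallel edges, so the lift chosen for `e` serves every edge between these
      -- two vertices.
      have hs : s(X.ends e' false, X.ends e' true) = s(X.ends e false, X.ends e true) := by
        cases b <;> cases b' <;> simp_all [Sym2.eq_swap]
      obtain rfl : e' = e := hC.no_parallel hs
      obtain rfl : b' = b := by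
        by_contra hb
        rw [Bool.eq_not.2 hb] at h1
        exact hne h1.symm
      exact ⟨g, hg, rfl, hgx⟩
  obtain ⟨s, hs⟩ := exists_section hC.simple_isTree R hR r ⟨x₀, hx₀⟩ hlift
  have hs' : ∀ e, ∃ g : PSL(2, ℤ), mkEdge G g = e ∧ treeT.ends g false = (s (X.ends e false)).1 ∧
      treeT.ends g true = (s (X.ends e true)).1 := fun e =>
    hs _ _ (toSimpleGraph_adj.2 ⟨hC.no_loops e, e, false, rfl, rfl⟩) e false rfl rfl
  choose f hf1 hf2 hf3 using hs'
  refine ⟨⟨fun v => (s v).1, f, ?_⟩, ?_⟩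
  · rintro e (_ | _)
    exacts [(hf2 e).symm, (hf3 e).symm]
  · exact Multigraph.Hom.ext (funext fun v => (s v).2) (funext hf1)


/-! ### Unions of triangles -/

/-- The union of the triangles that correspond to a set of edges. -/
def polygon (E : Set PSL(2, ℤ)) : Set ℍ := ⋃ g ∈ E, g • triangle

lemma mem_polygon {E : Set PSL(2, ℤ)} {z : ℍ} : z ∈ polygon E ↔ ∃ g ∈ E, z ∈ g • triangle := by
  simp only [polygon, Set.mem_iUnion, exists_prop]

lemma isClosed_polygon (E : Set PSL(2, ℤ)) : IsClosed (polygon E) := by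
  rw [polygon, Set.biUnion_eq_iUnion]
  exact (locallyFinite_triangle.comp_injective Subtype.val_injective).isClosed_iUnion
    fun g => isClosed_smul_triangle g

lemma smul_triangleInt_subset_interior {E : Set PSL(2, ℤ)} {g : PSL(2, ℤ)} (hg : g ∈ E) :
    g • triangleInt ⊆ interior (polygon E) :=
  interior_maximal (fun _ hz => mem_polygon.2 ⟨g, hg, Set.smul_set_mono triangleInt_subset hz⟩)
    (isOpen_triangleInt.smul g)

lemma smul_triangle_subset_closure (g : PSL(2, ℤ)) : g • triangle ⊆ closure (g • triangleInt) := by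
  rw [closure_smul]
  exact Set.smul_set_mono triangle_subset_closure

lemma closure_interior_polygon (E : Set PSL(2, ℤ)) :
    closure (interior (polygon E)) = polygon E := by
  refine Set.Subset.antisymm (closure_minimal interior_subset (isClosed_polygon E)) fun z hz => ?_
  obtain ⟨g, hg, hz⟩ := mem_polygon.1 hz
  exact closure_mono (smul_triangleInt_subset_interior hg) (smul_triangle_subset_closure g hz)

/-- Interiors of triangles are dense, so statements about interiors can be tested at points lying in
a single triangle. -/
lemma exists_mem_smul_triangleInt {W : Set ℍ} (hW : IsOpen W) (hne : W.Nonempty) :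
    ∃ y ∈ W, ∃ h : PSL(2, ℤ), y ∈ h • triangleInt := by
  obtain ⟨x, hx⟩ := hne
  obtain ⟨h, hxh⟩ := exists_mem_smul_triangle x
  obtain ⟨y, hyW, hy⟩ := mem_closure_iff.1 (smul_triangle_subset_closure h hxh) W hW hx
  exact ⟨y, hyW, h, hy⟩

lemma notMem_cornerSides {z : ℍ} (hz : z ∈ triangleInt) : z ∉ cornerSides := fun h => by
  obtain ⟨-, h1, h2⟩ := hz
  rcases (mem_cornerSides.1 h).2 with h3 | h3 <;> linarith

lemma eq_of_mem_smul_triangleInt {g h : PSL(2, ℤ)} {z : ℍ} (hh : z ∈ h • triangleInt)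
    (hg : z ∈ g • triangle) : g = h := by
  rw [Set.mem_smul_set_iff_inv_smul_mem] at hh
  rw [mem_smul_triangle] at hg
  rcases triangle_inter (k := h⁻¹ * g) (triangleInt_subset hh) (by simpa [mul_smul] using hg) with
    h1 | ⟨-, h1⟩ | ⟨-, h1⟩
  · exact (inv_mul_eq_one.1 h1).symm
  · exact absurd h1 hh.1.ne'
  · exact absurd h1 (notMem_cornerSides hh)

/-- An overlap of interiors of the polygon and its g-translate contains a point of a single
triangle, so e = ge' with e, e' ∈ E. These lie in one coset, whence e = e' and g = 1. -/
lemma isFundDomain_polygon {G : Subgroup PSL(2, ℤ)} {E : Set PSL(2, ℤ)}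
    (hcov : ∀ h, ∃ e ∈ E, mkEdge G e = mkEdge G h)
    (huniq : ∀ e ∈ E, ∀ e' ∈ E, mkEdge G e = mkEdge G e' → e = e') :
    IsFundDomain G (polygon E) where
  closure_interior := closure_interior_polygon E
  cover := by
    refine Set.eq_univ_of_forall fun z => ?_
    obtain ⟨h, hz⟩ := exists_mem_smul_triangle z
    obtain ⟨e, he, heh⟩ := hcov h
    refine Set.mem_iUnion.2 ⟨⟨_, mkEdge_eq.1 heh⟩, ?_⟩
    rw [Set.mem_smul_set_iff_inv_smul_mem]
    refine mem_polygon.2 ⟨e, he, ?_⟩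
    rw [mem_smul_triangle] at hz ⊢
    change e⁻¹ • (h * e⁻¹)⁻¹ • z ∈ triangle
    rwa [← mul_smul, mul_inv_rev, inv_inv, inv_mul_cancel_left]
  disjoint g hg := by
    rw [Set.disjoint_iff_inter_eq_empty]
    by_contra hne
    obtain ⟨y, ⟨hy1, hy2⟩, h, hy⟩ := exists_mem_smul_triangleInt
      (isOpen_interior.inter isOpen_interior) (Set.nonempty_iff_ne_empty.2 hne)
    obtain ⟨e, he, hye⟩ := mem_polygon.1 (interior_subset hy1)
    obtain ⟨e', he', hye'⟩ := mem_polygon.1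
      (Set.mem_smul_set_iff_inv_smul_mem.1 (interior_subset hy2))
    have hye2 : y ∈ ((g : PSL(2, ℤ)) * e') • triangle := by
      rw [mul_smul]; exact Set.mem_smul_set_iff_inv_smul_mem.2 hye'
    have h1 := (eq_of_mem_smul_triangleInt hy hye).trans (eq_of_mem_smul_triangleInt hy hye2).symm
    have h2 : e = e' := huniq e he e' he' (by rw [h1, mkEdge_mul g.2])
    rw [h2, eq_comm, mul_eq_right] at h1
    exact hg (Subtype.ext h1)

/-! ### Half-planes bounding a union of triangles -/

/-- Right multiplication by `gS` or by `gU` or its inverse inside a set of edges. -/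
def Step (E : Set PSL(2, ℤ)) (g h : PSL(2, ℤ)) : Prop :=
  h ∈ E ∧ (h = g * gS ∨ ∃ k, (k = gU ∨ k = gU⁻¹) ∧ h = g * k)

lemma not_reduced_one (b : Bool) : ¬Reduced b 1 := fun h => by
  obtain ⟨z, hz⟩ := nonempty_triangleInt
  have h1 := h.smul_mem_side (triangleInt_subset hz)
  rw [one_smul] at h1
  cases b
  · exact absurd h1 (not_le.2 hz.1)
  · exact notMem_cornerSides hz (mem_cornerSides_of_mem_side (triangleInt_subset hz) h1)

/-- A path in E starting at g cannot get past a neighbour of g that is missing from E. Undoing the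
last step preserves the type of the first syllable, unless the path has just landed on that missing
neighbour. -/
lemma not_reduced_of_reflTransGen {E : Set PSL(2, ℤ)} {g h : PSL(2, ℤ)} {b : Bool}
    (hS : b = false → g * gS ∉ E)
    (hU : b = true → g * gU ∉ E ∧ g * gU⁻¹ ∉ E)
    (hgh : Relation.ReflTransGen (Step E) g h) : ¬Reduced b (g⁻¹ * h) := by
  induction hgh with
  | refl => rw [inv_mul_cancel]; exact not_reduced_one b
  | @tail x y _ hxy ih =>
    intro hr
    obtain ⟨hy, hxy⟩ := hxy
    have hg : ∀ k, g⁻¹ * y = k → y = g * k := fun k hk => by rw [← hk, mul_inv_cancel_left]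
    rcases hxy with hxy | ⟨k, hk, hxy⟩
    · rcases hr.mul_right.1 with h1 | ⟨hb, h1⟩
      · rw [hxy, mul_assoc, mul_assoc, gS_mul_self, mul_one] at h1
        exact ih h1
      · exact hS hb (hg _ h1 ▸ hy)
    · have hk' : k⁻¹ = gU ∨ k⁻¹ = gU⁻¹ := by
        rcases hk with rfl | rfl
        exacts [Or.inr rfl, Or.inl (inv_inv _)]
      rcases hr.mul_right.2 k⁻¹ hk' with h1 | ⟨hb, h1 | h1⟩
      · rw [hxy, mul_assoc, mul_assoc, mul_inv_cancel, mul_one] at h1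
        exact ih h1
      · exact (hU hb).1 (hg _ h1 ▸ hy)
      · exact (hU hb).2 (hg _ h1 ▸ hy)

/-- The half-plane to the right of the imaginary axis. -/
def hp₀ : Set ℍ := {z | 0 ≤ z.re}

/-- The half-plane to the left of the vertical line through `e^{πi/3}`. -/
def hp₁ : Set ℍ := {z | z.re ≤ 1 / 2}

/-- The exterior of the circle with centre `1` and radius `1`. -/
def hp₂ : Set ℍ := {z | 2 * z.re ≤ nsq z}

lemma isClosedHalfPlane_hp₀ : IsClosedHalfPlane hp₀ :=
  ⟨0, 1, 0, by norm_num, by simp [hp₀]⟩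

lemma isClosedHalfPlane_hp₁ : IsClosedHalfPlane hp₁ :=
  ⟨0, -1, 1 / 2, by norm_num, by
    ext z
    simp only [hp₁, Set.mem_ofPred_eq]
    constructor <;> intro h <;> linarith⟩

lemma isClosedHalfPlane_hp₂ : IsClosedHalfPlane hp₂ :=
  ⟨1, -2, 0, by norm_num, by
    ext z
    simp only [hp₂, Set.mem_ofPred_eq, norm_sq_coe]
    constructor <;> intro h <;> linarith⟩

/-- The half-planes that correspond to the sides of a union of triangles. -/
def halfPlanes (E : Set PSL(2, ℤ)) : Set (Set ℍ) :=
  (fun g : PSL(2, ℤ) => g • hp₀) '' {g ∈ E | g * gS ∉ E} ∪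
    ((fun g : PSL(2, ℤ) => g • hp₁) '' {g ∈ E | g * gU ∉ E} ∪
      (fun g : PSL(2, ℤ) => g • hp₂) '' {g ∈ E | g * gU ∉ E})

lemma isClosedHalfPlane_of_mem {E : Set PSL(2, ℤ)} {H : Set ℍ} (hH : H ∈ halfPlanes E) :
    IsClosedHalfPlane H := by
  rcases hH with ⟨g, -, rfl⟩ | ⟨g, -, rfl⟩ | ⟨g, -, rfl⟩
  exacts [isClosedHalfPlane_hp₀.smul g, isClosedHalfPlane_hp₁.smul g, isClosedHalfPlane_hp₂.smul g]

lemma finite_halfPlanes {E : Set PSL(2, ℤ)} (hE : E.Finite) : (halfPlanes E).Finite :=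
  ((hE.sep _).image _).union (((hE.sep _).image _).union ((hE.sep _).image _))

variable {E : Set PSL(2, ℤ)}

/-- If E stops at a side of g△, no word g⁻¹h with h ∈ E starts across that side, so ping-pong keeps
h△ in the half-plane. -/
lemma polygon_subset_sInter (hconn : ∀ g ∈ E, ∀ h ∈ E, Relation.ReflTransGen (Step E) g h)
    (htri : ∀ g ∈ E, (g * gU ∈ E ↔ g * gU⁻¹ ∈ E)) : polygon E ⊆ ⋂₀ halfPlanes E := by
  intro z hz H hH
  obtain ⟨h, hh, hz⟩ := mem_polygon.1 hz
  rw [mem_smul_triangle] at hz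
  have hzg : ∀ g : PSL(2, ℤ), g⁻¹ • z = (g⁻¹ * h) • h⁻¹ • z := fun g => by
    rw [← mul_smul, mul_assoc, mul_inv_cancel, mul_one]
  have hU : ∀ g ∈ E, g * gU ∉ E → (g⁻¹ • z).re ≤ 1 / 2 ∧ 2 * (g⁻¹ • z).re ≤ nsq (g⁻¹ • z) := by
    intro g hg hgU
    have hr := not_reduced_of_reflTransGen (b := true) (by simp)
      (fun _ => ⟨hgU, fun h => hgU ((htri g hg).2 h)⟩) (hconn g hg h hh)
    rw [hzg]
    rcases eq_one_or_reduced (g⁻¹ * h) with h1 | h1 | h1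
    · rw [h1, one_smul]; exact (mem_triangle.1 hz).2
    · exact wedge_of_mem_side (h1.smul_mem_side hz)
    · exact absurd h1 hr
  rcases hH with ⟨g, ⟨hg, hgS⟩, rfl⟩ | ⟨g, ⟨hg, hgU⟩, rfl⟩ | ⟨g, ⟨hg, hgU⟩, rfl⟩
  · have hr := not_reduced_of_reflTransGen (b := false) (fun _ => hgS) (by simp) (hconn g hg h hh)
    refine Set.mem_smul_set_iff_inv_smul_mem.2 ?_
    rw [hzg]
    rcases eq_one_or_reduced (g⁻¹ * h) with h1 | h1 | h1
    · rw [h1, one_smul]; exact (mem_triangle.1 hz).1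
    · exact absurd h1 hr
    · exact (re_pos_of_mem_side (h1.smul_mem_side hz)).le
  · exact Set.mem_smul_set_iff_inv_smul_mem.2 (hU g hg hgU).1
  · exact Set.mem_smul_set_iff_inv_smul_mem.2 (hU g hg hgU).2

lemma mem_polygon_of_side_false {g : PSL(2, ℤ)} {z : ℍ} (hz : z ∈ ⋂₀ halfPlanes E) (hg : g ∈ E)
    (hgS : g * gS ∉ E) (hs : g⁻¹ • z ∈ side false) : z ∈ polygon E := by
  refine mem_polygon.2 ⟨g, hg, ?_⟩
  have h1 : 0 ≤ (g⁻¹ • z).re :=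
    Set.mem_smul_set_iff_inv_smul_mem.1 (hz (g • hp₀) (Or.inl ⟨g, ⟨hg, hgS⟩, rfl⟩))
  rw [mem_smul_triangle, mem_triangle]
  exact ⟨h1, wedge_of_mem_side hs⟩

lemma mem_polygon_of_side_true {g : PSL(2, ℤ)} {z : ℍ} (hz : z ∈ ⋂₀ halfPlanes E) (hg : g ∈ E)
    (hgU : g * gU ∉ E) (hs : g⁻¹ • z ∈ side true) : z ∈ polygon E := by
  refine mem_polygon.2 ⟨g, hg, ?_⟩
  have h1 : (g⁻¹ • z).re ≤ 1 / 2 :=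
    Set.mem_smul_set_iff_inv_smul_mem.1 (hz (g • hp₁) (Or.inr (Or.inl ⟨g, ⟨hg, hgU⟩, rfl⟩)))
  have h2 : 2 * (g⁻¹ • z).re ≤ nsq (g⁻¹ • z) :=
    Set.mem_smul_set_iff_inv_smul_mem.1 (hz (g • hp₂) (Or.inr (Or.inr ⟨g, ⟨hg, hgU⟩, rfl⟩)))
  rw [mem_smul_triangle, mem_triangle]
  exact ⟨(re_pos_of_mem_side hs).le, h1, h2⟩

/-- Follow the reduced word from some g ∈ E towards a triangle containing z. At the first step out
of E, ping-pong gives the inequalities for the sides not being crossed and the half-planes give the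
others, so z lies in the current triangle. -/
lemma sInter_subset_polygon (hne : E.Nonempty) (htri : ∀ g ∈ E, (g * gU ∈ E ↔ g * gU⁻¹ ∈ E)) :
    ⋂₀ halfPlanes E ⊆ polygon E := by
  intro z hz
  have key : ∀ b w, Reduced b w → ∀ g ∈ E, z ∈ (g * w) • triangle → z ∈ polygon E := by
    intro b w hw
    have hside : ∀ {b w}, Reduced b w → ∀ {g : PSL(2, ℤ)}, z ∈ (g * w) • triangle →
        g⁻¹ • z ∈ side b := by
      intro b w hw g hzw
      rw [mem_smul_triangle] at hzw
      have := hw.smul_mem_side hzw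
      rwa [← mul_smul, mul_inv_rev, mul_inv_cancel_left] at this
    induction hw with
    | S =>
      intro g hg hzw
      by_cases h : g * gS ∈ E
      · exact mem_polygon.2 ⟨_, h, hzw⟩
      · exact mem_polygon_of_side_false hz hg h (hside .S hzw)
    | U =>
      intro g hg hzw
      by_cases h : g * gU ∈ E
      · exact mem_polygon.2 ⟨_, h, hzw⟩
      · exact mem_polygon_of_side_true hz hg h (hside .U hzw)
    | U_inv =>
      intro g hg hzw
      by_cases h : g * gU ∈ E
      · exact mem_polygon.2 ⟨_, (htri g hg).1 h, hzw⟩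
      · exact mem_polygon_of_side_true hz hg h (hside .U_inv hzw)
    | S_mul hw ih =>
      intro g hg hzw
      by_cases h : g * gS ∈ E
      · exact ih _ h (by rwa [mul_assoc])
      · exact mem_polygon_of_side_false hz hg h (hside (.S_mul hw) hzw)
    | U_mul hw ih =>
      intro g hg hzw
      by_cases h : g * gU ∈ E
      · exact ih _ h (by rwa [mul_assoc])
      · exact mem_polygon_of_side_true hz hg h (hside (.U_mul hw) hzw)
    | U_inv_mul hw ih =>
      intro g hg hzw
      by_cases h : g * gU ∈ E
      · exact ih _ ((htri g hg).1 h) (by rwa [mul_assoc])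
      · exact mem_polygon_of_side_true hz hg h (hside (.U_inv_mul hw) hzw)
  obtain ⟨g, hg⟩ := hne
  obtain ⟨h, hh⟩ := exists_mem_smul_triangle z
  have hgh : h = g * (g⁻¹ * h) := by rw [mul_inv_cancel_left]
  rcases eq_one_or_reduced (g⁻¹ * h) with h1 | h1 | h1
  · exact mem_polygon.2 ⟨g, hg, by rwa [← inv_mul_eq_one.1 h1] at hh⟩
  · exact key _ _ h1 g hg (by rwa [← hgh])
  · exact key _ _ h1 g hg (by rwa [← hgh])

lemma locallyFinite_smul {L : Set ℍ} {K : Set PSL(2, ℤ)} (hK : K.Finite)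
    (hL : ∀ z ∈ L, ∃ k ∈ K, z ∈ k • triangle) : LocallyFinite fun g : PSL(2, ℤ) => g • L := by
  intro z
  choose U hU hfin using fun k : PSL(2, ℤ) =>
    (locallyFinite_triangle.comp_injective (mul_left_injective k)) z
  refine ⟨⋂ k ∈ K, U k, (Filter.biInter_mem hK).2 fun k _ => hU k,
    (hK.biUnion fun k _ => hfin k).subset ?_⟩
  rintro g ⟨w, hw, hwU⟩
  obtain ⟨k, hk, hwk⟩ := hL _ (Set.mem_smul_set_iff_inv_smul_mem.1 hw)
  refine Set.mem_biUnion hk ⟨w, ?_, Set.mem_iInter₂.1 hwU k hk⟩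
  change w ∈ (g * k) • triangle
  rw [mul_smul]
  exact Set.mem_smul_set_iff_inv_smul_mem.2 hwk

lemma frontier_smul_le_subset {f h : ℍ → ℝ} (hf : Continuous f) (hh : Continuous h)
    (g : PSL(2, ℤ)) : frontier (g • {z | f z ≤ h z}) ⊆ g • {z | f z = h z} := by
  have e : g • {z | f z ≤ h z} = {z | f (g⁻¹ • z) ≤ h (g⁻¹ • z)} :=
    Set.ext fun z => Set.mem_smul_set_iff_inv_smul_mem
  rw [e]
  intro z hz
  exact Set.mem_smul_set_iff_inv_smul_mem.2 (frontier_le_subset_eq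
    (hf.comp (continuous_const_smul g⁻¹)) (hh.comp (continuous_const_smul g⁻¹)) hz)

/-- Above `corner` the line is a side of the triangle. Below it, U⁻¹ carries it into the unit circle
with real part 1 - q/2, where q = 1/|z|² ranges over [1, 4); at q = 2 and q = 3 this real part is 0
and -1/2, where the next triangle begins. -/
lemma exists_of_re_eq_half {z : ℍ} (hz : z.re = 1 / 2) :
    ∃ k ∈ ({1, gU, gU * gS, gU * gS * gU⁻¹} : Set PSL(2, ℤ)), z ∈ k • triangle := by
  have hN := nsq_pos z
  have hN4 := re_sq_lt_nsq z
  have e1 : (gU⁻¹ • z).re = 1 - 1 / (2 * nsq z) := by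
    rw [re_gU_inv, hz]; field_simp
  have e2 : nsq (gU⁻¹ • z) = 1 := by
    rw [nsq_gU_inv, hz, div_eq_one_iff_eq hN.ne']; ring
  rcases le_total 1 (nsq z) with h1 | h1
  · refine ⟨1, by simp, ?_⟩
    rw [one_smul, mem_triangle, hz]
    exact ⟨by norm_num, le_rfl, by linarith⟩
  · have h1' : 1 ≤ 1 / nsq z := by rwa [le_div_iff₀ hN, one_mul]
    have e0 : 1 / (2 * nsq z) = 1 / nsq z / 2 := by rw [div_div, mul_comm]
    rw [e0] at e1
    rcases le_total (1 / nsq z) 2 with h2 | h2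
    · refine ⟨gU, by simp, ?_⟩
      rw [mem_smul_triangle, mem_triangle, e1, e2]
      exact ⟨by linarith, by linarith, by linarith⟩
    · have e3 : (gS • gU⁻¹ • z).re = 1 / nsq z / 2 - 1 := by rw [re_gS, e1, e2]; ring
      have e4 : nsq (gS • gU⁻¹ • z) = 1 := by rw [nsq_gS, e2, div_one]
      rcases le_total (1 / nsq z) 3 with h3 | h3
      · refine ⟨gU * gS, by simp, ?_⟩
        rw [mem_smul_triangle, mul_inv_rev, gS_inv, mul_smul, mem_triangle, e3, e4]
        exact ⟨by linarith, by linarith, by linarith⟩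
      · refine ⟨gU * gS * gU⁻¹, by simp, ?_⟩
        have h4 := nsq_sub_pos (gS • gU⁻¹ • z)
        rw [mem_smul_triangle, mul_inv_rev, mul_inv_rev, inv_inv, gS_inv, mul_smul, mul_smul,
          mem_triangle, re_gU, nsq_gU, e3, e4]
        rw [e3, e4] at h4
        have e5 : (1 - (1 / nsq z / 2 - 1)) / (1 - 2 * (1 / nsq z / 2 - 1) + 1) = 1 / 2 := by
          rw [div_eq_iff h4.ne']; ring
        rw [e5, le_div_iff₀ h4]
        exact ⟨by norm_num, le_rfl, by linarith⟩

lemma locallyFinite_frontier_hp₀ : LocallyFinite fun g : PSL(2, ℤ) => frontier (g • hp₀) := by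
  refine (locallyFinite_smul (L := {z : ℍ | 0 = z.re}) (Set.finite_singleton 1) ?_).subset
    fun g => frontier_smul_le_subset continuous_const UpperHalfPlane.continuous_re g
  intro z hz
  have hN := nsq_pos z
  have hz' : z.re = 0 := Eq.symm hz
  refine ⟨1, rfl, ?_⟩
  rw [one_smul, mem_triangle, hz']
  exact ⟨le_rfl, by norm_num, by linarith⟩

lemma locallyFinite_frontier_hp₁ : LocallyFinite fun g : PSL(2, ℤ) => frontier (g • hp₁) :=
  (locallyFinite_smul (L := {z : ℍ | z.re = 1 / 2})
    (K := {1, gU, gU * gS, gU * gS * gU⁻¹}) (by simp) fun _ hz => exists_of_re_eq_half hz).subset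
    fun g => frontier_smul_le_subset UpperHalfPlane.continuous_re continuous_const g

lemma locallyFinite_frontier_hp₂ : LocallyFinite fun g : PSL(2, ℤ) => frontier (g • hp₂) := by
  refine (locallyFinite_smul (L := {z : ℍ | 2 * z.re = nsq z})
    (K := gU • ({1, gU, gU * gS, gU * gS * gU⁻¹} : Set PSL(2, ℤ)))
    (Set.Finite.smul_set (by simp)) fun z hz => ?_).subset
    fun g => frontier_smul_le_subset (by fun_prop) continuous_nsq g
  have h : (gU⁻¹ • z).re = 1 / 2 := by
    have hN := nsq_pos z
    change 2 * z.re = nsq z at hz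
    rw [re_gU_inv, div_eq_iff hN.ne']
    linarith
  obtain ⟨k, hk, hzk⟩ := exists_of_re_eq_half h
  refine ⟨gU * k, Set.smul_mem_smul_set hk, ?_⟩
  rw [mul_smul]
  exact Set.mem_smul_set_iff_inv_smul_mem.2 hzk

lemma locallyFinite_halfPlanes (E : Set PSL(2, ℤ)) :
    LocallyFinite fun H : halfPlanes E => frontier (H : Set ℍ) := by
  intro z
  obtain ⟨U₀, hU₀, hf₀⟩ := locallyFinite_frontier_hp₀ z
  obtain ⟨U₁, hU₁, hf₁⟩ := locallyFinite_frontier_hp₁ z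
  obtain ⟨U₂, hU₂, hf₂⟩ := locallyFinite_frontier_hp₂ z
  refine ⟨U₀ ∩ (U₁ ∩ U₂), Filter.inter_mem hU₀ (Filter.inter_mem hU₁ hU₂), ?_⟩
  refine ((((hf₀.image fun g => g • hp₀).union ((hf₁.image fun g => g • hp₁).union
    (hf₂.image fun g => g • hp₂)))).preimage Subtype.val_injective.injOn).subset ?_
  rintro ⟨H, hH⟩ ⟨w, hwH, hw0, hw1, hw2⟩
  have hw : w ∈ frontier H := hwH
  clear hwH
  rcases hH with ⟨g, -, rfl⟩ | ⟨g, -, rfl⟩ | ⟨g, -, rfl⟩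
  exacts [Or.inl ⟨g, ⟨w, hw, hw0⟩, rfl⟩, Or.inr (Or.inl ⟨g, ⟨w, hw, hw1⟩, rfl⟩),
    Or.inr (Or.inr ⟨g, ⟨w, hw, hw2⟩, rfl⟩)]

lemma polygon_eq_sInter (hne : E.Nonempty)
    (hconn : ∀ g ∈ E, ∀ h ∈ E, Relation.ReflTransGen (Step E) g h)
    (htri : ∀ g ∈ E, (g * gU ∈ E ↔ g * gU⁻¹ ∈ E)) : polygon E = ⋂₀ halfPlanes E :=
  (polygon_subset_sInter hconn htri).antisymm (sInter_subset_polygon hne htri)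

lemma isConvexPolygon_polygon (hne : E.Nonempty)
    (hconn : ∀ g ∈ E, ∀ h ∈ E, Relation.ReflTransGen (Step E) g h)
    (htri : ∀ g ∈ E, (g * gU ∈ E ↔ g * gU⁻¹ ∈ E)) : IsConvexPolygon (polygon E) := by
  have e := polygon_eq_sInter hne hconn htri
  refine ⟨?_, ?_, halfPlanes E, fun _ => isClosedHalfPlane_of_mem, locallyFinite_halfPlanes E, e⟩
  · rw [e]
    exact isGeodesicallyConvex_sInter fun _ => isClosedHalfPlane_of_mem
  · obtain ⟨g, hg⟩ := hne
    exact (nonempty_triangleInt.smul_set (a := g)).mono (smul_triangleInt_subset_interior hg)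

/-! ### Preimages under a retraction -/

variable {p : ℍ → ℍ}

lemma IsTreeRetraction.apply_mem (hp : IsTreeRetraction p) {g : PSL(2, ℤ)} {z : ℍ}
    (hz : z ∈ g • triangle) : p z ∈ g • segR := by
  rw [mem_smul_triangle] at hz
  refine Set.mem_smul_set_iff_inv_smul_mem.2 ?_
  rw [← hp.equivariant]
  exact hp.mapsTo hz

lemma segR_subset_triangle : segR ⊆ triangle := by
  rintro _ ⟨t, rfl⟩
  exact arc_mem_triangle t

/-- Distinct segments of 𝓣 meet at most in a common vertex. Over a translate of i the fibre in h△ is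
the side shared with e△; over a translate of `corner` the fibre consists of two sides, one of which
need not belong to e△. -/
lemma IsTreeRetraction.cases_of_mem (hp : IsTreeRetraction p) {h e : PSL(2, ℤ)} {z : ℍ}
    (hz : z ∈ h • triangle) (hpz : p z ∈ e • segR) :
    z ∈ e • triangle ∨
      (e = h * gU ∨ e = h * gU⁻¹) ∧ p z = e • corner ∧ h⁻¹ • z ∈ cornerSides := by
  have hz' := mem_smul_triangle.1 hz
  have h1 : p (h⁻¹ • z) ∈ segR := hp.mapsTo hz'
  have h2 : (h⁻¹ * e)⁻¹ • p (h⁻¹ • z) ∈ triangle := by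
    rw [hp.equivariant, mul_inv_rev, inv_inv, mul_smul, smul_inv_smul]
    exact segR_subset_triangle (Set.mem_smul_set_iff_inv_smul_mem.1 hpz)
  have he : ∀ k, h⁻¹ * e = k → e = h * k := fun k hk => by rw [← hk, mul_inv_cancel_left]
  obtain ⟨t, ht⟩ := h1
  have ht' := arc_mem_triangle t
  rw [← ht] at h2
  rcases triangle_inter ht' h2 with h3 | ⟨h3, h4⟩ | ⟨h3, h4⟩
  · left
    rwa [← inv_mul_eq_one.1 h3]
  · left
    have h5 : t = 0 := by rw [← level_arc t, level_eq_zero ht']; exact h4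
    rw [h5, arc_zero] at ht
    have h6 := (hp.eq_I_iff _ hz').1 ht.symm
    rw [he _ h3, mem_smul_triangle, mul_inv_rev, gS_inv, mul_smul]
    exact gS_smul_mem_triangle h6.le (by rw [h6]; norm_num)
      (by rw [h6]; simpa using (nsq_pos _).le)
  · right
    have h5 : t = 1 := by rw [← level_arc t, level_eq_one ht']; exact h4
    rw [h5, arc_one] at ht
    refine ⟨h3.imp (he _) (he _), ?_, (hp.eq_corner_iff _ hz').1 ht.symm⟩
    have h6 : (h⁻¹ * e) • corner = corner := G₁_smul (mem_G₁.2 (Or.inr h3))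
    rw [hp.equivariant, eq_inv_smul_iff] at ht
    rw [← ht]
    conv_lhs => rw [← h6]
    rw [← mul_smul, mul_inv_cancel_left]

lemma polygon_subset_preimage (hp : IsTreeRetraction p) :
    polygon E ⊆ p ⁻¹' ⋃ g ∈ E, g • segR := by
  intro z hz
  obtain ⟨g, hg, hz⟩ := mem_polygon.1 hz
  exact Set.mem_biUnion hg (hp.apply_mem hz)

/-- The exceptional points in `cases_of_mem` lie on sides of triangles, so an open set of them would
contradict density of the interiors. -/
lemma interior_preimage_subset (hp : IsTreeRetraction p) :
    interior (p ⁻¹' ⋃ g ∈ E, g • segR) ⊆ polygon E := by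
  by_contra hcon
  obtain ⟨z, hz, hz'⟩ := Set.not_subset.1 hcon
  obtain ⟨y, ⟨hy1, hy2⟩, h, hy⟩ := exists_mem_smul_triangleInt
    (isOpen_interior.inter (isClosed_polygon E).isOpen_compl) ⟨z, hz, hz'⟩
  obtain ⟨e, he, hye⟩ := Set.mem_iUnion₂.1 (Set.mem_preimage.1 (interior_subset hy1))
  have hyh := Set.mem_smul_set_iff_inv_smul_mem.1 hy
  rcases hp.cases_of_mem (Set.smul_set_mono triangleInt_subset hy) hye with h1 | ⟨-, -, h1⟩
  · exact hy2 (mem_polygon.2 ⟨e, he, h1⟩)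
  · exact notMem_cornerSides hyh h1

lemma closure_interior_preimage (hp : IsTreeRetraction p) :
    closure (interior (p ⁻¹' ⋃ g ∈ E, g • segR)) = polygon E := by
  refine Set.Subset.antisymm
    (closure_minimal (interior_preimage_subset hp) (isClosed_polygon E)) ?_
  rw [← closure_interior_polygon E]
  exact closure_mono (interior_mono (polygon_subset_preimage hp))


/-! ### Lifts of cut graphs -/

variable {G : Subgroup PSL(2, ℤ)} {C : Set (XComb G).Vert}
  {j : Multigraph.Hom ((XComb G).cut C) treeT}

/-- The edge of the tree `𝐓` that is the lift of a given edge. -/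
def liftEdge (j : Multigraph.Hom ((XComb G).cut C) treeT) (e : (XComb G).Edge) : PSL(2, ℤ) :=
  j.edge e

/-- The edges of a lift. -/
def liftSet (j : Multigraph.Hom ((XComb G).cut C) treeT) : Set PSL(2, ℤ) := Set.range (liftEdge j)

lemma mkEdge_liftEdge (hj : (treeProj G).comp j = (XComb G).cutProj C) (e : (XComb G).Edge) :
    mkEdge G (liftEdge j e) = e :=
  congrFun (congrArg Multigraph.Hom.edge hj) e

lemma vert_cutEnds (e : (XComb G).Edge) (b : Bool) :
    j.vert (cutEnds C e b) = treeT.ends (liftEdge j e) b := j.comm e b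

lemma eq_of_mem_liftSet (hj : (treeProj G).comp j = (XComb G).cutProj C) {g h : PSL(2, ℤ)}
    (hg : g ∈ liftSet j) (hh : h ∈ liftSet j) (hgh : mkEdge G g = mkEdge G h) : g = h := by
  obtain ⟨e, rfl⟩ := hg
  obtain ⟨e', rfl⟩ := hh
  rw [mkEdge_liftEdge hj, mkEdge_liftEdge hj] at hgh
  rw [hgh]

lemma exists_mem_liftSet (hj : (treeProj G).comp j = (XComb G).cutProj C) (h : PSL(2, ℤ)) :
    ∃ e ∈ liftSet j, mkEdge G e = mkEdge G h :=
  ⟨_, ⟨mkEdge G h, rfl⟩, mkEdge_liftEdge hj _⟩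

lemma mul_of_ends_true_eq {g h : PSL(2, ℤ)} (H : treeT.ends g true = treeT.ends h true) :
    h = g ∨ h = g * gU ∨ h = g * gU⁻¹ := by
  have h1 : g⁻¹ * h ∈ G₁ := QuotientGroup.eq.1 (Sum.inr.inj H)
  have he : ∀ k, g⁻¹ * h = k → h = g * k := fun k hk => by rw [← hk, mul_inv_cancel_left]
  rcases mem_G₁.1 h1 with h2 | h2 | h2
  exacts [Or.inl (by simpa using he _ h2), Or.inr (Or.inl (he _ h2)), Or.inr (Or.inr (he _ h2))]

lemma mul_of_ends_false_eq {g h : PSL(2, ℤ)} (H : treeT.ends g false = treeT.ends h false) :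
    h = g ∨ h = g * gS := by
  have h1 : g⁻¹ * h ∈ G₀ := QuotientGroup.eq.1 (Sum.inl.inj H)
  have he : ∀ k, g⁻¹ * h = k → h = g * k := fun k hk => by rw [← hk, mul_inv_cancel_left]
  rcases mem_G₀.1 h1 with h2 | h2
  exacts [Or.inl (by simpa using he _ h2), Or.inr (he _ h2)]

lemma reflTransGen_of_cutEnds_eq {e e' : (XComb G).Edge} {b b' : Bool}
    (h : cutEnds C e b = cutEnds C e' b') :
    Relation.ReflTransGen (Step (liftSet j)) (liftEdge j e) (liftEdge j e') := by
  have hb : b = b' := by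
    have := congrArg ((XComb G).cutProj C).vert h
    rw [cutProj_cutEnds, cutProj_cutEnds] at this
    simpa [isRight_ends] using congrArg Sum.isRight this
  subst hb
  have H : treeT.ends (liftEdge j e) b = treeT.ends (liftEdge j e') b := by
    rw [← vert_cutEnds, ← vert_cutEnds, h]
  have hmem : liftEdge j e' ∈ liftSet j := ⟨e', rfl⟩
  cases b
  · rcases mul_of_ends_false_eq H with h1 | h1
    · rw [h1]
    · exact .single ⟨hmem, Or.inl h1⟩
  · rcases mul_of_ends_true_eq H with h1 | h1 | h1
    · rw [h1]
    · exact .single ⟨hmem, Or.inr ⟨_, Or.inl rfl, h1⟩⟩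
    · exact .single ⟨hmem, Or.inr ⟨_, Or.inr rfl, h1⟩⟩

lemma reflTransGen_of_walk {u v : ((XComb G).cut C).Vert}
    (w : ((XComb G).cut C).toSimpleGraph.Walk u v) :
    ∀ (e e' : (XComb G).Edge) (b b' : Bool), cutEnds C e b = u → cutEnds C e' b' = v →
      Relation.ReflTransGen (Step (liftSet j)) (liftEdge j e) (liftEdge j e') := by
  induction w with
  | nil => exact fun e e' b b' h h' => reflTransGen_of_cutEnds_eq (h.trans h'.symm)
  | cons hadj _ ih =>
    intro e e' b b' h h'
    obtain ⟨-, x, c, h1, h2⟩ := toSimpleGraph_adj.1 hadj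
    exact (reflTransGen_of_cutEnds_eq (b' := c) (h.trans h1.symm)).trans (ih x e' (!c) b' h2 h')

lemma reflTransGen_liftSet (hC : ((XComb G).cut C).IsTree) :
    ∀ g ∈ liftSet j, ∀ h ∈ liftSet j, Relation.ReflTransGen (Step (liftSet j)) g h := by
  rintro _ ⟨e, rfl⟩ _ ⟨e', rfl⟩
  obtain ⟨w⟩ := hC.simple_isTree.connected.preconnected (cutEnds C e true) (cutEnds C e' true)
  exact reflTransGen_of_walk w e e' true true rfl rfl

lemma ends_true_notMem (hC : ∀ v ∈ C, (XComb G).valency v = 2) (e : (XComb G).Edge) :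
    (XComb G).ends e true ∉ C := fun h => valency_ends_true_ne_two e (hC _ h)

lemma mem_liftSet_of_ends_true_eq (hC : ∀ v ∈ C, (XComb G).valency v = 2)
    (hj : (treeProj G).comp j = (XComb G).cutProj C) {g : PSL(2, ℤ)} (hg : g ∈ liftSet j)
    {e : (XComb G).Edge} (he : (XComb G).ends e true = (XComb G).ends (mkEdge G g) true) :
    liftEdge j e = g ∨ liftEdge j e = g * gU ∨ liftEdge j e = g * gU⁻¹ := by
  obtain ⟨x, rfl⟩ := hg
  rw [mkEdge_liftEdge hj] at he
  refine mul_of_ends_true_eq ?_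
  rw [← vert_cutEnds, ← vert_cutEnds]
  congr 1
  rw [cutEnds_of_notMem (ends_true_notMem hC x)]
  exact (cutEnds_eq_uncut.2 he).symm

/-- Vertices of type 1 are never cut, so the lifts of the edges at one of them still share an end;
three different cosets then fill all three places around it. -/
lemma mul_gU_mem_liftSet (hC : ∀ v ∈ C, (XComb G).valency v = 2)
    (hj : (treeProj G).comp j = (XComb G).cutProj C) {g : PSL(2, ℤ)} (hg : g ∈ liftSet j)
    (hne : mkEdge G g ≠ mkEdge G (g * gU)) : g * gU ∈ liftSet j ∧ g * gU⁻¹ ∈ liftSet j := by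
  have hne' : mkEdge G g ≠ mkEdge G (g * gU⁻¹) := by rwa [Ne, mkEdge_gU_inv_eq_iff]
  have hne'' : mkEdge G (g * gU) ≠ mkEdge G (g * gU⁻¹) := by rwa [Ne, mkEdge_gU_inv_eq_gU_iff]
  constructor
  · have h1 := mkEdge_liftEdge hj (mkEdge G (g * gU))
    rcases mem_liftSet_of_ends_true_eq hC hj hg (ends_true_eq.2 (Or.inr (Or.inl rfl))) with
      h | h | h
    · rw [h] at h1; exact absurd h1 hne
    · exact ⟨_, h⟩
    · rw [h] at h1; exact absurd h1.symm hne''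
  · have h1 := mkEdge_liftEdge hj (mkEdge G (g * gU⁻¹))
    rcases mem_liftSet_of_ends_true_eq hC hj hg (ends_true_eq.2 (Or.inr (Or.inr rfl))) with
      h | h | h
    · rw [h] at h1; exact absurd h1 hne'
    · rw [h] at h1; exact absurd h1 hne''
    · exact ⟨_, h⟩

lemma mul_gU_mem_liftSet_iff (hC : ∀ v ∈ C, (XComb G).valency v = 2)
    (hj : (treeProj G).comp j = (XComb G).cutProj C) :
    ∀ g ∈ liftSet j, (g * gU ∈ liftSet j ↔ g * gU⁻¹ ∈ liftSet j) := by
  intro g hg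
  by_cases h : mkEdge G g = mkEdge G (g * gU)
  · refine iff_of_false (fun h1 => ?_) (fun h1 => ?_)
    · exact gU_ne_one (by simpa using eq_of_mem_liftSet hj hg h1 h)
    · have := eq_of_mem_liftSet hj hg h1 ((mkEdge_gU_inv_eq_iff g).2 h)
      exact gU_ne_one (by simpa using this)
  · exact iff_of_true (mul_gU_mem_liftSet hC hj hg h).1 (mul_gU_mem_liftSet hC hj hg h).2

lemma range_treeMap_realize (j : Multigraph.Hom ((XComb G).cut C) treeT) :
    Set.range (treeMap ∘ j.realize) = ⋃ g ∈ liftSet j, g • segR := by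
  have hends : ∀ v : ((XComb G).cut C).Vert, ∃ e b, ((XComb G).cut C).ends e b = v := by
    rintro (⟨v, hv⟩ | ⟨⟨e, b⟩, h⟩)
    · obtain ⟨e, b, rfl⟩ := exists_ends_eq v
      exact ⟨e, b, cutEnds_of_notMem hv⟩
    · exact ⟨e, b, cutEnds_of_mem h⟩
  ext z
  simp only [Set.mem_iUnion, exists_prop]
  constructor
  · rintro ⟨x, rfl⟩
    obtain ⟨e, t, rfl⟩ := realization_cases hends x
    exact ⟨liftEdge j e, ⟨e, rfl⟩, Set.smul_mem_smul_set ⟨t, rfl⟩⟩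
  · rintro ⟨_, ⟨e, rfl⟩, _, ⟨t, rfl⟩, rfl⟩
    exact ⟨edgePt (X := (XComb G).cut C) e t, rfl⟩

lemma liftSet_nonempty (j : Multigraph.Hom ((XComb G).cut C) treeT) : (liftSet j).Nonempty :=
  ⟨_, mkEdge G 1, rfl⟩

lemma finite_liftSet [G.FiniteIndex] (j : Multigraph.Hom ((XComb G).cut C) treeT) :
    (liftSet j).Finite := by
  have : Finite (XComb G).Edge :=
    Finite.of_equiv _ (QuotientGroup.quotientRightRelEquivQuotientLeftRel G).symm
  exact Set.finite_range _

/-- If the vertex of type 1 on e has valency 3, the neighbour h of e also belongs to the lift and z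
is in the polygon. Only valency 1 leaves room for extra points. -/
lemma exists_of_mem_diff (hC : ∀ v ∈ C, (XComb G).valency v = 2)
    (hj : (treeProj G).comp j = (XComb G).cutProj C) {p : ℍ → ℍ} (hp : IsTreeRetraction p) {z : ℍ}
    (hz : z ∈ p ⁻¹' ⋃ g ∈ liftSet j, g • segR) (hz' : z ∉ polygon (liftSet j)) :
    ∃ g ∈ liftSet j, mkEdge G g = mkEdge G (g * gU) ∧ p z = g • corner := by
  obtain ⟨e, he, hpz⟩ := Set.mem_iUnion₂.1 (Set.mem_preimage.1 hz)
  obtain ⟨h, hzh⟩ := exists_mem_smul_triangle z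
  rcases hp.cases_of_mem hzh hpz with h1 | ⟨h1, h2, -⟩
  · exact absurd (mem_polygon.2 ⟨e, he, h1⟩) hz'
  · refine ⟨e, he, ?_, h2⟩
    by_contra hne
    obtain ⟨h3, h4⟩ := mul_gU_mem_liftSet hC hj he hne
    refine hz' (mem_polygon.2 ⟨h, ?_, hzh⟩)
    rcases h1 with rfl | rfl
    · rwa [mul_inv_cancel_right] at h4
    · rwa [inv_mul_cancel_right] at h3

lemma orderOf_conj_gU (g : PSL(2, ℤ)) : orderOf (g * gU * g⁻¹) = 3 := by
  refine orderOf_eq_prime ?_ fun h => gU_ne_one ?_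
  · rw [conj_pow, show gU ^ 3 = 1 by rw [pow_succ, pow_two, gU_cube], mul_one, mul_inv_cancel]
  · rwa [conj_eq_one_iff] at h

end ModularPolygon

end

/-! ### The main theorem -/

theorem mainTheorem3 (G : Subgroup PSL(2, ℤ)) :
    -- the graph is homotopy equivalent to the quotient surface
    Nonempty ((XComb G).Realization ≃ₕ MulAction.orbitRel.Quotient G ℍ) ∧
    -- the retraction, the cuts and the lifts that are used below exist
    (∃ p : ℍ → ℍ, IsTreeRetraction p) ∧
    (∃ C : Set (XComb G).Vert,
      (∀ v ∈ C, (XComb G).valency v = 2) ∧ ((XComb G).cut C).IsTree) ∧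
    ∀ C : Set (XComb G).Vert,
      (∀ v ∈ C, (XComb G).valency v = 2) → ((XComb G).cut C).IsTree →
      (∃ j : Multigraph.Hom ((XComb G).cut C) treeT,
        (treeProj G).comp j = (XComb G).cutProj C) ∧
      ∀ j : Multigraph.Hom ((XComb G).cut C) treeT,
        (treeProj G).comp j = (XComb G).cutProj C →
        ∀ p : ℍ → ℍ, IsTreeRetraction p →
          ∀ P₀ P : Set ℍ,
            P₀ = p ⁻¹' Set.range (treeMap ∘ j.realize) →
            P = closure (interior P₀) →
            -- `P` and the preimage `P₀` agree away from the points over the univalent vertices of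
            -- type 1 of the cut graph
            P ⊆ P₀ ∧
            (∀ z ∈ P₀ \ P, ∃ v : ((XComb G).cut C).Vert, ((XComb G).cut C).valency v = 1 ∧
              (j.vert v).isRight ∧ p z = vertexPoint (j.vert v)) ∧
            ((∀ g ∈ G, orderOf g ≠ 3) → P = P₀) ∧
            -- `P` is a union of `Γ`-copies of the triangle
            P = ⋃ g ∈ {g : PSL(2, ℤ) | ∃ e, j.edge e = g}, g • triangle ∧
            -- `P` is a convex polygon, with finitely many sides if `G` has finite index
            IsConvexPolygon P ∧
            (G.FiniteIndex → HasFinitelyManySides P) ∧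
            -- `P` is a fundamental domain for `G`
            IsFundDomain G P := by
  refine ⟨nonempty_homotopyEquiv G, ⟨_, isTreeRetraction_treeMap_toTree⟩, exists_cut_isTree G,
    fun C hC hT => ⟨exists_lift hT, fun j hj p hp P₀ P hP₀ hP => ?_⟩⟩
  rw [range_treeMap_realize] at hP₀
  -- From here on P is `polygon (liftSet j)`, so the description as a union of triangles holds by
  -- `rfl`.
  rw [hP₀, closure_interior_preimage hp] at hP
  have hconn := reflTransGen_liftSet (j := j) hT
  have htri := mul_gU_mem_liftSet_iff hC hj
  subst hP₀ hP
  refine ⟨polygon_subset_preimage hp, ?_, ?_, rfl,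
    isConvexPolygon_polygon (liftSet_nonempty j) hconn htri, fun hG => ?_,
    isFundDomain_polygon (exists_mem_liftSet hj)
      fun e he e' he' h => eq_of_mem_liftSet hj he he' h⟩
  · rintro z ⟨hz, hz'⟩
    obtain ⟨_, ⟨e, rfl⟩, hg, hpz⟩ := exists_of_mem_diff hC hj hp hz hz'
    refine ⟨Multigraph.cutEnds C e true, ?_, ?_, ?_⟩
    · have h1 := valency_ends_true_of_eq hg
      rw [mkEdge_liftEdge hj] at h1
      rw [Multigraph.cutEnds_of_notMem (ends_true_notMem hC e), Multigraph.valency_uncut, h1]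
    · rw [vert_cutEnds]; rfl
    · rw [vert_cutEnds, hpz]; rfl
  · intro hG
    refine (polygon_subset_preimage hp).antisymm fun z hz => ?_
    by_contra hz'
    obtain ⟨g, -, hg, -⟩ := exists_of_mem_diff hC hj hp hz hz'
    exact hG _ (mkEdge_eq.1 hg) (orderOf_conj_gU g)
  · exact ⟨_, finite_halfPlanes (finite_liftSet j), fun _ => isClosedHalfPlane_of_mem,
      polygon_eq_sInter (liftSet_nonempty j) hconn htri⟩
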